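/- **Factorization systems.** Let $\mathscr C$ be a category. A *factorization system* on $\mathscr C$ consists of two classes $\mathscr E,\mathscr M$ of morphisms, each containing the isomorphisms and closed under composition, such that (FS1) whenever $mu=ve$ with $e\in\mathscr E$, $m\in\mathscr M$ there is a unique $w$ with $we=u$ and $mw=v$; (FS2) every morphism is of the form $m\circ e$ with $e\in\mathscr E$, $m\in\mathscr M$. It is *suitable* when: - (SFS1) pullbacks of arbitrary morphisms along members of $\mathscr M$ exist; - (SFS2) pushouts of arbitrary morphisms along members of $\mathscr E$ exist; - (SFS3) the pullback of an $\mathscr E$ along an $\mathscr M$ is in $\mathscr E$; - (SFS4) the pushout of an $\mathscr M$ along an $\mathscr E$ is in $\mathscr M$; - (SFS5) a commutative square $d\circ n=m\circ e$ with $m,n\in\mathscr M$ and $d,e\in\mathscr E$ is a pullback if and only if it is a pushout. **The bicategory of spans.** For a suitable $(\mathscr E,\mathscr M)$, the bicategory $\mathrm{Spn}(\mathscr E,\mathscr M)$ has the objects of $\mathscr C$; its morphisms $U\to W$ are spans $(d,R,m)$, $U\xleftarrow{d}R\xrightarrow{m}W$ with $d\in\mathscr E$, $m\in\mathscr M$;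 its 2-cells are the usual morphisms of spans; composition is the usual composition of spans by pullback. For $m:X\to Y$ in $\mathscr M$ put $m_*=(1_X,X,m):X\to Y$, and for $e:X\to Y$ in $\mathscr E$ put $e^*=(e,X,1_X):Y\to X$. Let $\mathscr M_*$ (respectively $\mathscr E^*$) be the class of all morphisms of $\mathrm{Spn}(\mathscr E,\mathscr M)$ isomorphic to some $m_*$ with $m\in\mathscr M$ (respectively some $e^*$ with $e\in\mathscr E$). **Factorization systems on bicategories.** A square $f p\cong g q$ in a bicategory $\mathscr S$, with apex $P$ and $f:X\to Z$, $g:Y\to Z$, is a *bipullback* if for every object $K$ the induced functor from $\mathscr S(K,P)$ to the pseudopullback of $\mathscr S(K,X)\to\mathscr S(K,Z)\leftarrow\mathscr S(K,Y)$ is an equivalence. A *factorization system* $(\mathscr U,\mathscr L)$ on $\mathscr S$ consists of two classes of morphisms, each containing the equivalences and closed under composition and under isomorphism of morphisms, such that for all $e:X\to Y$ in $\mathscr U$ and $m:A\to D$ in $\mathscr L$ the induced functor from $\mathscr S(Y,A)$ to the pseudopullback of $\mathscr S(X,A)\to\mathscr S(X,D)\leftarrow\mathscr S(Y,D)$ is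 an equivalence, and such that every morphism $f$ satisfies $f\cong m\circ e$ for some $e\in\mathscr U$, $m\in\mathscr L$. **Fake pullback readiness.** A bicategory $\mathscr S$ with a pair $(\mathscr U,\mathscr L)$ of classes of morphisms is *fake pullback ready* when it is locally preordered (there is at most one 2-cell between any two parallel morphisms), $(\mathscr U,\mathscr L)$ is a factorization system on it, and the following hold, where $\Rightarrow$ denotes existence of a 2-cell. - (V1) Bipullbacks of $\mathscr U$s along $\mathscr U$s exist and have both projections in $\mathscr U$; bipullbacks of $\mathscr L$s along $\mathscr L$s exist and have both projections in $\mathscr L$. - (V2) Given $X\xrightarrow{a}Z\xleftarrow{x}Y$ with $a\in\mathscr U$, $x\in\mathscr L$, there exist an object $T$ and morphisms $b:T\to Y$ in $\mathscr U$, $y:T\to X$ in $\mathscr L$ with $x b\Rightarrow a y$; and $(T,b,y)$ is unique up to equivalence: for any other such $(T',b',y')$ there is an equivalence $s:T\to T'$ with $b's\cong b$ and $y's\cong y$. - (V3) Given $X\xrightarrow{x}Y\xrightarrow{a}Z$, $A\xrightarrow{y}B\xrightarrow{b}D$, $r:X\to A$, $s:Y\to B$, $t:Z\to D$ with $r,s,t,x,y\in\mathscr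 L$ and $a,b\in\mathscr U$, a bipullback square $s x\cong y r$ and a 2-cell $t a\Rightarrow b s$, and given factorizations $a x\cong v c$ and $b y\cong w d$ with $c:X\to I$, $d:A\to J$ in $\mathscr U$ and $v:I\to Z$, $w:J\to D$ in $\mathscr L$, there exists $q:I\to J$ in $\mathscr L$ with $q c\Rightarrow d r$ and a bipullback square $t v\cong w q$. - (V4) Given $D\xrightarrow{u}T\xrightarrow{h}F$, $X\xrightarrow{x}Y\xrightarrow{a}Z$, $e:D\to X$, $f:T\to Y$, $g:F\to Z$ with $x,u\in\mathscr L$ and $h,a,e,f,g\in\mathscr U$, a bipullback square $g h\cong a f$ and a 2-cell $x e\Rightarrow f u$, and given factorizations $h u\cong p k$ and $a x\cong v c$ with $k:D\to K$, $c:X\to I$ in $\mathscr U$ and $p:K\to F$, $v:I\to Z$ in $\mathscr L$, there exists $j:K\to I$ in $\mathscr U$ with $v j\Rightarrow g p$ and a bipullback square $j k\cong c e$. **Proposition.** Let $(\mathscr E,\mathscr M)$ be a suitable factorization system on a category $\mathscr C$. Then the bicategory $\mathrm{Spn}(\mathscr E,\mathscr M)$, equipped with $(\mathscr E^*,\mathscr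 M_*)$, is fake pullback ready. -/

import Mathlib

universe w v u

namespace EMSpan

open CategoryTheory CategoryTheory.Limits

section Suitable

variable {C : Type u} [Category.{v} C]

/-- An (orthogonal) factorization system `(E, M)` on a category: two classes of morphisms containing
the isomorphisms and closed under composition, such that every commutative square with an `E` on
one side and an `M` on the opposite side has a unique diagonal, and every morphism is an `E`
followed by an `M`. -/
class IsFactorizationSystem (E M : MorphismProperty C) : Prop where
  left_of_isIso : ∀ ⦃X Y : C⦄ (f : X ⟶ Y), IsIso f → E f
  right_of_isIso : ∀ ⦃X Y : C⦄ (f : X ⟶ Y), IsIso f → M f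
  left_comp : ∀ ⦃X Y Z : C⦄ (f : X ⟶ Y) (g : Y ⟶ Z), E f → E g → E (f ≫ g)
  right_comp : ∀ ⦃X Y Z : C⦄ (f : X ⟶ Y) (g : Y ⟶ Z), M f → M g → M (f ≫ g)
  existsUnique_diagonal : ∀ ⦃X Y A B : C⦄ (e : X ⟶ Y) (m : A ⟶ B) (p : X ⟶ A) (q : Y ⟶ B),
    E e → M m → p ≫ m = e ≫ q → ∃! d : Y ⟶ A, e ≫ d = p ∧ d ≫ m = q
  exists_factorization : ∀ ⦃X Y : C⦄ (f : X ⟶ Y),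
    ∃ (Z : C) (e : X ⟶ Z) (m : Z ⟶ Y), E e ∧ M m ∧ e ≫ m = f

/-- A suitable factorization system. -/
class IsSuitable (E M : MorphismProperty C) : Prop extends IsFactorizationSystem E M where
  /-- Pullbacks of arbitrary morphisms along members of `M` exist. -/
  hasPullback : ∀ ⦃X Y Z : C⦄ (f : X ⟶ Z) (m : Y ⟶ Z), M m → HasPullback f m
  /-- Pushouts of arbitrary morphisms along members of `E` exist. -/
  hasPushout : ∀ ⦃X Y Z : C⦄ (f : Z ⟶ X) (e : Z ⟶ Y), E e → HasPushout f e
  /-- The pullback `e'` of a member `e` of `E` along a member `m` of `M` is in `E`. -/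
  left_of_isPullback : ∀ ⦃P X Y Z : C⦄ (m' : P ⟶ X) (e' : P ⟶ Y) (e : X ⟶ Z) (m : Y ⟶ Z),
    IsPullback m' e' e m → E e → M m → E e'
  /-- The pushout `m'` of a member `m` of `M` along a member `e` of `E` is in `M`. -/
  right_of_isPushout : ∀ ⦃Z X Y P : C⦄ (m : Z ⟶ X) (e : Z ⟶ Y) (e' : X ⟶ P) (m' : Y ⟶ P),
    IsPushout m e e' m' → M m → E e → M m'
  /-- A commutative square with horizontal sides in `M` and vertical sides in `E` is a pullback
  if and only if it is a pushout. -/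
  isPullback_iff_isPushout : ∀ ⦃D A B X : C⦄ (n : D ⟶ B) (e : D ⟶ A) (d : B ⟶ X) (m : A ⟶ X),
    M n → E e → E d → M m → n ≫ d = e ≫ m → (IsPullback n e d m ↔ IsPushout n e d m)

/-- In a factorization system the class `M` is stable under pullback. -/
theorem IsFactorizationSystem.right_of_isPullback {E M : MorphismProperty C}
    [IsFactorizationSystem E M] {P X Y Z : C} {p : P ⟶ X} {q : P ⟶ Y} {f : X ⟶ Z} {m : Y ⟶ Z}
    (h : IsPullback p q f m) (hm : M m) : M p := by
  obtain ⟨I, e, n, he, hn, fac⟩ := exists_factorization (E := E) (M := M) p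
  obtain ⟨d, ⟨hd₁, hd₂⟩, -⟩ := existsUnique_diagonal (E := E) (M := M) e m q (n ≫ f) he hm
    (by rw [← Category.assoc, fac, h.w])
  let s : I ⟶ P := h.lift n d hd₂.symm
  have hs₁ : s ≫ p = n := h.lift_fst ..
  have hs₂ : s ≫ q = d := h.lift_snd ..
  have h₁ : e ≫ s = 𝟙 P := by
    apply h.hom_ext
    · simp [hs₁, fac]
    · simp [hs₂, hd₁]
  obtain ⟨_, _, uniq⟩ := existsUnique_diagonal (E := E) (M := M) e n e n he hn rfl
  have h₂ : s ≫ e = 𝟙 I := by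
    rw [uniq (s ≫ e) ⟨by rw [← Category.assoc, h₁, Category.id_comp],
      by rw [Category.assoc, fac, hs₁]⟩, uniq (𝟙 I) (by simp)]
  have : IsIso e := ⟨s, h₁, h₂⟩
  rw [← fac]
  exact right_comp (E := E) e n (right_of_isIso (E := E) e this) hn

end Suitable

section Bicategories

open Bicategory

variable {B : Type u} [Bicategory.{w, v} B]

/-- For a square `p ≫ f ≅ q ≫ g` in a bicategory with apex `P`, the comparison functor from
`K ⟶ P` to the pseudopullback of `(K ⟶ X) ⥤ (K ⟶ Z)` and `(K ⟶ Y) ⥤ (K ⟶ Z)`. -/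
@[simps]
def bipullbackComparison {P X Y Z : B} {p : P ⟶ X} {q : P ⟶ Y} {f : X ⟶ Z} {g : Y ⟶ Z}
    (α : p ≫ f ≅ q ≫ g) (K : B) :
    (K ⟶ P) ⥤ CategoricalPullback (postcomp K f) (postcomp K g) where
  obj k :=
    { fst := k ≫ p
      snd := k ≫ q
      iso := α_ k p f ≪≫ whiskerLeftIso k α ≪≫ (α_ k q g).symm }
  map η :=
    { fst := η ▷ p
      snd := η ▷ q
      w := by
        change η ▷ p ▷ f ≫ (α_ _ p f).hom ≫ _ ◁ α.hom ≫ (α_ _ q g).inv =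
          ((α_ _ p f).hom ≫ _ ◁ α.hom ≫ (α_ _ q g).inv) ≫ η ▷ q ▷ g
        rw [associator_naturality_left_assoc, Category.assoc, Category.assoc,
          ← associator_inv_naturality_left, whisker_exchange_assoc] }

/-- The square `p ≫ f ≅ q ≫ g` is a bipullback of `f` and `g`. -/
def IsBipullback {P X Y Z : B} {p : P ⟶ X} {q : P ⟶ Y} {f : X ⟶ Z} {g : Y ⟶ Z}
    (α : p ≫ f ≅ q ≫ g) : Prop :=
  ∀ K : B, (bipullbackComparison α K).IsEquivalence

/-- For `e : X ⟶ Y` and `m : A ⟶ D` in a bicategory, the comparison functor from `Y ⟶ A` to the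
pseudopullback of `(X ⟶ A) ⥤ (X ⟶ D)` and `(Y ⟶ D) ⥤ (X ⟶ D)`. -/
@[simps]
def diagonalComparison {X Y A D : B} (e : X ⟶ Y) (m : A ⟶ D) :
    (Y ⟶ A) ⥤ CategoricalPullback (postcomp X m) (precomp D e) where
  obj k :=
    { fst := e ≫ k
      snd := k ≫ m
      iso := α_ e k m }
  map η :=
    { fst := e ◁ η
      snd := η ▷ m
      w := by
        change (e ◁ η) ▷ m ≫ (α_ e _ m).hom = (α_ e _ m).hom ≫ e ◁ η ▷ m
        simp }

/-- The 1-cell `f` of a bicategory is an equivalence. -/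
def IsEquivalence₁ {X Y : B} (f : X ⟶ Y) : Prop :=
  ∃ s : X ≌ Y, Nonempty (s.hom ≅ f)

/-- A factorization system `(U, L)` on a bicategory: the classes contain the equivalences, are
closed under composition and under isomorphism of 1-cells, the squares of hom-categories
expressing the diagonal property are bipullbacks, and every morphism is isomorphic to a
member of `U` followed by a member of `L`. -/
structure IsBicatFactorizationSystem (U L : MorphismProperty B) : Prop where
  left_of_equivalence : ∀ ⦃X Y : B⦄ (f : X ⟶ Y), IsEquivalence₁ f → U f
  right_of_equivalence : ∀ ⦃X Y : B⦄ (f : X ⟶ Y), IsEquivalence₁ f → L f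
  left_of_iso : ∀ ⦃X Y : B⦄ (f g : X ⟶ Y), (f ≅ g) → U f → U g
  right_of_iso : ∀ ⦃X Y : B⦄ (f g : X ⟶ Y), (f ≅ g) → L f → L g
  left_comp : ∀ ⦃X Y Z : B⦄ (f : X ⟶ Y) (g : Y ⟶ Z), U f → U g → U (f ≫ g)
  right_comp : ∀ ⦃X Y Z : B⦄ (f : X ⟶ Y) (g : Y ⟶ Z), L f → L g → L (f ≫ g)
  diagonal : ∀ ⦃X Y A D : B⦄ (e : X ⟶ Y) (m : A ⟶ D), U e → L m →
    (diagonalComparison e m).IsEquivalence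
  exists_factorization : ∀ ⦃X Y : B⦄ (f : X ⟶ Y),
    ∃ (Z : B) (e : X ⟶ Z) (m : Z ⟶ Y), U e ∧ L m ∧ Nonempty (e ≫ m ≅ f)

/-- A class `W` of morphisms of a bicategory such that bipullbacks of `W`s along `W`s exist and
have both projections in `W`. -/
structure HasBipullbacksWithin (W : MorphismProperty B) : Prop where
  exists_bipullback : ∀ ⦃X Y Z : B⦄ (f : X ⟶ Z) (g : Y ⟶ Z), W f → W g →
    ∃ (P : B) (p : P ⟶ X) (q : P ⟶ Y) (α : p ≫ f ≅ q ≫ g), IsBipullback α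
  projections_mem : ∀ ⦃P X Y Z : B⦄ (p : P ⟶ X) (q : P ⟶ Y) (f : X ⟶ Z) (g : Y ⟶ Z)
    (α : p ≫ f ≅ q ≫ g), W f → W g → IsBipullback α → W p ∧ W q

/-- The bicategory `B`, equipped with the classes `U` and `L`, is fake pullback ready.

Since `B` is locally preordered, all diagrams of 2-cells commute, so no compatibility between
2-cells has to be demanded. -/
structure FakePullbackReady (U L : MorphismProperty B) : Prop where
  locallyPreordered : ∀ X Y : B, Quiver.IsThin (X ⟶ Y)
  factorizationSystem : IsBicatFactorizationSystem U L
  /-- Condition V1. -/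
  bipullbacks_left : HasBipullbacksWithin U
  bipullbacks_right : HasBipullbacksWithin L
  /-- Condition V2, existence. -/
  exists_square : ∀ ⦃X Y Z : B⦄ (a : X ⟶ Z) (x : Y ⟶ Z), U a → L x →
    ∃ (T : B) (b : T ⟶ Y) (y : T ⟶ X), U b ∧ L y ∧ Nonempty (b ≫ x ⟶ y ≫ a)
  /-- Condition V2, uniqueness up to equivalence. -/
  square_unique : ∀ ⦃X Y Z : B⦄ (a : X ⟶ Z) (x : Y ⟶ Z), U a → L x →
    ∀ ⦃T T' : B⦄ (b : T ⟶ Y) (y : T ⟶ X) (b' : T' ⟶ Y) (y' : T' ⟶ X),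
      U b → L y → (b ≫ x ⟶ y ≫ a) → U b' → L y' → (b' ≫ x ⟶ y' ≫ a) →
      ∃ s : T ≌ T', Nonempty (s.hom ≫ b' ≅ b) ∧ Nonempty (s.hom ≫ y' ≅ y)
  /-- Condition V3:
  ```
   X -x-> Y -a-> Z             X -c-> I -v-> Z
   |r bpb |s  ⇙  |t    gives   |r  ⇙  |q bpb |t
   A -y-> B -b-> D             A -d-> J -w-> D
  ```
  -/
  exchange_right : ∀ ⦃X Y Z A B' D : B⦄ (x : X ⟶ Y) (a : Y ⟶ Z) (y : A ⟶ B') (b : B' ⟶ D)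
    (r : X ⟶ A) (s : Y ⟶ B') (t : Z ⟶ D) (α : x ≫ s ≅ r ≫ y),
    L r → L s → L t → L x → L y → U a → U b →
    IsBipullback α → (a ≫ t ⟶ s ≫ b) →
    ∀ ⦃I J : B⦄ (c : X ⟶ I) (v : I ⟶ Z) (d : A ⟶ J) (w : J ⟶ D),
      U c → L v → U d → L w → (x ≫ a ≅ c ≫ v) → (y ≫ b ≅ d ≫ w) →
      ∃ q : I ⟶ J, L q ∧ Nonempty (c ≫ q ⟶ r ≫ d) ∧
        ∃ β : v ≫ t ≅ q ≫ w, IsBipullback β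
  /-- Condition V4:
  ```
   D -u-> T -h-> F             D -k-> K -p-> F
   |e  ⇗  |f bpb |g    gives   |e bpb |j  ⇗  |g
   X -x-> Y -a-> Z             X -c-> I -v-> Z
  ```
  -/
  exchange_left : ∀ ⦃D T F X Y Z : B⦄ (u : D ⟶ T) (h : T ⟶ F) (x : X ⟶ Y) (a : Y ⟶ Z)
    (e : D ⟶ X) (f : T ⟶ Y) (g : F ⟶ Z) (α : h ≫ g ≅ f ≫ a),
    L x → L u → U h → U a → U e → U f → U g →
    IsBipullback α → (e ≫ x ⟶ u ≫ f) →
    ∀ ⦃K I : B⦄ (k : D ⟶ K) (p : K ⟶ F) (c : X ⟶ I) (v : I ⟶ Z),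
      U k → L p → U c → L v → (u ≫ h ≅ k ≫ p) → (x ≫ a ≅ c ≫ v) →
      ∃ j : K ⟶ I, U j ∧ Nonempty (j ≫ v ⟶ p ≫ g) ∧
        ∃ β : k ≫ j ≅ e ≫ c, IsBipullback β

end Bicategories

section SpanBicategory

variable {C : Type u} [Category.{v} C]

/-- The objects of the bicategory `Spn(E, M)`: they are the objects of the category. -/
structure Spn (E M : MorphismProperty C) : Type u where
  /-- The underlying object of the category. -/
  as : C

namespace Spn

variable {E M : MorphismProperty C} [IsSuitable E M]

instance {U V W : C} (S : Span E M U V) (T : Span E M V W) : HasPullback S.r T.l :=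
  have := IsSuitable.hasPullback (E := E) T.l S.r S.wr
  hasPullback_symmetry T.l S.r

/-- The identity span. -/
abbrev idSpan (U : C) : Span E M U U where
  apex := U
  l := 𝟙 U
  r := 𝟙 U
  wl := IsFactorizationSystem.left_of_isIso M _ inferInstance
  wr := IsFactorizationSystem.right_of_isIso E _ inferInstance

/-- The usual composite of spans, by pullback. -/
noncomputable def compSpan {U V W : C} (S : Span E M U V) (T : Span E M V W) : Span E M U W where
  apex := pullback S.r T.l
  l := pullback.fst S.r T.l ≫ S.l
  r := pullback.snd S.r T.l ≫ T.r
  wl := IsFactorizationSystem.left_comp (M := M) _ _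
    (IsSuitable.left_of_isPullback (M := M) _ _ _ _ (IsPullback.of_hasPullback S.r T.l).flip
      T.wl S.wr) S.wl
  wr := IsFactorizationSystem.right_comp (E := E) _ _
    (IsFactorizationSystem.right_of_isPullback (E := E)
      (IsPullback.of_hasPullback S.r T.l).flip S.wr) T.wr

section Coherence

variable {U V W X Y : C}

/-- The first projection of the pullback defining the composite of two spans. -/
noncomputable def fst (S : Span E M U V) (T : Span E M V W) : (compSpan S T).apex ⟶ S.apex :=
  pullback.fst S.r T.l

/-- The second projection of the pullback defining the composite of two spans. -/
noncomputable def snd (S : Span E M U V) (T : Span E M V W) : (compSpan S T).apex ⟶ T.apex :=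
  pullback.snd S.r T.l

theorem isPullback (S : Span E M U V) (T : Span E M V W) :
    IsPullback (fst S T) (snd S T) S.r T.l :=
  IsPullback.of_hasPullback S.r T.l

theorem condition (S : Span E M U V) (T : Span E M V W) : fst S T ≫ S.r = snd S T ≫ T.l :=
  pullback.condition

@[simp]
theorem compSpan_l (S : Span E M U V) (T : Span E M V W) : (compSpan S T).l = fst S T ≫ S.l := rfl

@[simp]
theorem compSpan_r (S : Span E M U V) (T : Span E M V W) : (compSpan S T).r = snd S T ≫ T.r := rfl

/-- The map to the apex of a composite of spans given by the universal property. -/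
noncomputable def lift (S : Span E M U V) (T : Span E M V W) {K : C} (a : K ⟶ S.apex)
    (b : K ⟶ T.apex) (h : a ≫ S.r = b ≫ T.l) : K ⟶ (compSpan S T).apex :=
  pullback.lift a b h

@[simp]
theorem lift_fst (S : Span E M U V) (T : Span E M V W) {K : C} (a : K ⟶ S.apex)
    (b : K ⟶ T.apex) (h : a ≫ S.r = b ≫ T.l) : lift S T a b h ≫ fst S T = a :=
  pullback.lift_fst ..

@[simp]
theorem lift_fst_assoc (S : Span E M U V) (T : Span E M V W) {K : C} (a : K ⟶ S.apex)
    (b : K ⟶ T.apex) (h : a ≫ S.r = b ≫ T.l) {L : C} (c : S.apex ⟶ L) :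
    lift S T a b h ≫ fst S T ≫ c = a ≫ c := by
  rw [← Category.assoc, lift_fst]

@[simp]
theorem lift_snd (S : Span E M U V) (T : Span E M V W) {K : C} (a : K ⟶ S.apex)
    (b : K ⟶ T.apex) (h : a ≫ S.r = b ≫ T.l) : lift S T a b h ≫ snd S T = b :=
  pullback.lift_snd ..

@[simp]
theorem lift_snd_assoc (S : Span E M U V) (T : Span E M V W) {K : C} (a : K ⟶ S.apex)
    (b : K ⟶ T.apex) (h : a ≫ S.r = b ≫ T.l) {L : C} (c : T.apex ⟶ L) :
    lift S T a b h ≫ snd S T ≫ c = b ≫ c := by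
  rw [← Category.assoc, lift_snd]

@[ext]
theorem hom_ext {S : Span E M U V} {T : Span E M V W} {K : C} {a b : K ⟶ (compSpan S T).apex}
    (h₁ : a ≫ fst S T = b ≫ fst S T) (h₂ : a ≫ snd S T = b ≫ snd S T) : a = b :=
  pullback.hom_ext h₁ h₂

/-- Whiskering on the left. -/
@[simps]
noncomputable def whiskerLeftSpan (S : Span E M U V) {T T' : Span E M V W} (η : T ⟶ T') :
    compSpan S T ⟶ compSpan S T' where
  hom := lift _ _ (fst S T) (snd S T ≫ η.hom) (by simp [condition])

/-- Whiskering on the right. -/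
@[simps]
noncomputable def whiskerRightSpan {S S' : Span E M U V} (η : S ⟶ S') (T : Span E M V W) :
    compSpan S T ⟶ compSpan S' T where
  hom := lift _ _ (fst S T ≫ η.hom) (snd S T) (by simp [condition])

/-- The associator, induced by the universal properties. -/
@[simps]
noncomputable def associatorSpan (S : Span E M U V) (T : Span E M V W) (R : Span E M W X) :
    compSpan (compSpan S T) R ≅ compSpan S (compSpan T R) where
  hom :=
    { hom := lift _ _ (fst _ _ ≫ fst _ _)
        (lift _ _ (fst _ _ ≫ snd _ _) (snd _ _)
          (by simpa using condition (compSpan S T) R))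
        (by simp [condition]) }
  inv :=
    { hom := lift _ _
        (lift _ _ (fst _ _) (snd _ _ ≫ fst _ _)
          (by simpa using condition S (compSpan T R)))
        (snd _ _ ≫ snd _ _)
        (by simp [condition]) }

/-- The left unitor. -/
@[simps]
noncomputable def leftUnitorSpan (S : Span E M U V) : compSpan (idSpan U) S ≅ S where
  hom := { hom := snd _ _, hom_l := by simp [← condition] }
  inv := { hom := lift (idSpan U) S S.l (𝟙 _) (by simp) }
  hom_inv_id := by
    ext
    · simpa using (condition (idSpan U) S).symm
    · simp

/-- The right unitor. -/
@[simps]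
noncomputable def rightUnitorSpan (S : Span E M U V) : compSpan S (idSpan V) ≅ S where
  hom := { hom := fst _ _, hom_r := by simp [condition] }
  inv := { hom := lift S (idSpan V) (𝟙 _) S.r (by simp) }
  hom_inv_id := by
    ext
    · simp
    · simpa using condition S (idSpan V)

theorem whiskerLeft_id_span (S : Span E M U V) (T : Span E M V W) :
    whiskerLeftSpan S (𝟙 T) = 𝟙 (compSpan S T) := by
  ext <;> simp

theorem whiskerLeft_comp_span (S : Span E M U V) {T T' T'' : Span E M V W} (η : T ⟶ T') (θ : T' ⟶ T'') :
    whiskerLeftSpan S (η ≫ θ) = whiskerLeftSpan S η ≫ whiskerLeftSpan S θ := by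
  ext <;> simp

theorem id_whiskerLeft_span {S T : Span E M U V} (η : S ⟶ T) :
    whiskerLeftSpan (idSpan U) η = (leftUnitorSpan S).hom ≫ η ≫ (leftUnitorSpan T).inv := by
  ext <;> simp
  simpa using condition (idSpan U) S

theorem comp_whiskerLeft_span (S : Span E M U V) (T : Span E M V W) {R R' : Span E M W X} (η : R ⟶ R') :
    whiskerLeftSpan (compSpan S T) η =
      (associatorSpan S T R).hom ≫ whiskerLeftSpan S (whiskerLeftSpan T η) ≫
        (associatorSpan S T R').inv := by
  ext <;> simp

theorem id_whiskerRight_span (S : Span E M U V) (T : Span E M V W) :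
    whiskerRightSpan (𝟙 S) T = 𝟙 (compSpan S T) := by
  ext <;> simp

theorem comp_whiskerRight_span {S S' S'' : Span E M U V} (η : S ⟶ S') (θ : S' ⟶ S'') (T : Span E M V W) :
    whiskerRightSpan (η ≫ θ) T = whiskerRightSpan η T ≫ whiskerRightSpan θ T := by
  ext <;> simp

theorem whiskerRight_id_span {S T : Span E M U V} (η : S ⟶ T) :
    whiskerRightSpan η (idSpan V) = (rightUnitorSpan S).hom ≫ η ≫ (rightUnitorSpan T).inv := by
  ext <;> simp
  simpa using (condition S (idSpan V)).symm

theorem whiskerRight_comp_span {S S' : Span E M U V} (η : S ⟶ S') (T : Span E M V W) (R : Span E M W X) :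
    whiskerRightSpan η (compSpan T R) =
      (associatorSpan S T R).inv ≫ whiskerRightSpan (whiskerRightSpan η T) R ≫
        (associatorSpan S' T R).hom := by
  ext <;> simp

theorem whisker_assoc_span (S : Span E M U V) {T T' : Span E M V W} (η : T ⟶ T') (R : Span E M W X) :
    whiskerRightSpan (whiskerLeftSpan S η) R =
      (associatorSpan S T R).hom ≫ whiskerLeftSpan S (whiskerRightSpan η R) ≫
        (associatorSpan S T' R).inv := by
  ext <;> simp

theorem whisker_exchange_span {S S' : Span E M U V} {T T' : Span E M V W} (η : S ⟶ S') (θ : T ⟶ T') :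
    whiskerLeftSpan S θ ≫ whiskerRightSpan η T' = whiskerRightSpan η T ≫ whiskerLeftSpan S' θ := by
  ext <;> simp

theorem pentagon_span (S : Span E M U V) (T : Span E M V W) (R : Span E M W X) (Q : Span E M X Y) :
    whiskerRightSpan (associatorSpan S T R).hom Q ≫ (associatorSpan S (compSpan T R) Q).hom ≫
        whiskerLeftSpan S (associatorSpan T R Q).hom =
      (associatorSpan (compSpan S T) R Q).hom ≫ (associatorSpan S T (compSpan R Q)).hom := by
  ext <;> simp

theorem triangle_span (S : Span E M U V) (T : Span E M V W) :
    (associatorSpan S (idSpan V) T).hom ≫ whiskerLeftSpan S (leftUnitorSpan T).hom =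
      whiskerRightSpan (rightUnitorSpan S).hom T := by
  ext <;> simp

end Coherence

/-- A span from `U` to `W` consists of a left leg in `E` and a right leg in `M`. -/
noncomputable instance : CategoryStruct (Spn E M) where
  Hom U W := Span E M U.as W.as
  id U := idSpan U.as
  comp S T := compSpan S T

/-- The 2-cells are the usual morphisms of spans. -/
instance (U W : Spn E M) : Category (U ⟶ W) :=
  inferInstanceAs (Category (Span E M U.as W.as))

/-- The bicategory `Spn(E, M)`. -/
noncomputable instance : Bicategory (Spn E M) where
  homCategory := inferInstance
  whiskerLeft S _ _ η := whiskerLeftSpan S η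
  whiskerRight η T := whiskerRightSpan η T
  associator S T R := associatorSpan S T R
  leftUnitor S := leftUnitorSpan S
  rightUnitor S := rightUnitorSpan S
  whiskerLeft_id := by intros; exact whiskerLeft_id_span ..
  whiskerLeft_comp := by intros; exact whiskerLeft_comp_span ..
  id_whiskerLeft := by intros; exact id_whiskerLeft_span ..
  comp_whiskerLeft := by intros; exact comp_whiskerLeft_span ..
  id_whiskerRight := by intros; exact id_whiskerRight_span ..
  comp_whiskerRight := by intros; exact comp_whiskerRight_span ..
  whiskerRight_id := by intros; exact whiskerRight_id_span ..
  whiskerRight_comp := by intros; exact whiskerRight_comp_span ..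
  whisker_assoc := by intros; exact whisker_assoc_span ..
  whisker_exchange := by intros; exact whisker_exchange_span ..
  pentagon := by intros; exact pentagon_span ..
  triangle := by intros; exact triangle_span ..

/-- The morphism `m_* = (1, X, m) : X ⟶ Y` of `Spn(E, M)` given by `m : X ⟶ Y` in `M`. -/
noncomputable def lowerStar {X Y : C} (m : X ⟶ Y) (hm : M m) : (⟨X⟩ : Spn E M) ⟶ ⟨Y⟩ :=
  show Span E M X Y from
    { apex := X
      l := 𝟙 X
      r := m
      wl := IsFactorizationSystem.left_of_isIso M _ inferInstance
      wr := hm }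

/-- The morphism `e^* = (e, X, 1) : Y ⟶ X` of `Spn(E, M)` given by `e : X ⟶ Y` in `E`. -/
noncomputable def upperStar {X Y : C} (e : X ⟶ Y) (he : E e) : (⟨Y⟩ : Spn E M) ⟶ ⟨X⟩ :=
  show Span E M Y X from
    { apex := X
      l := e
      r := 𝟙 X
      wl := he
      wr := IsFactorizationSystem.right_of_isIso E _ inferInstance }

variable (E M) in
/-- The class `M_*` of morphisms isomorphic to `m_*` for some `m` in `M`. -/
def lowerStarClass : MorphismProperty (Spn E M) :=
  fun X Y f => ∃ (m : X.as ⟶ Y.as) (hm : M m), Nonempty (f ≅ lowerStar m hm)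

variable (E M) in
/-- The class `E^*` of morphisms isomorphic to `e^*` for some `e` in `E`. -/
def upperStarClass : MorphismProperty (Spn E M) :=
  fun X Y f => ∃ (e : Y.as ⟶ X.as) (he : E e), Nonempty (f ≅ upperStar e he)

end Spn

end SpanBicategory

end EMSpan

/-! Everything rests on (SFS5). The pushout of a span with one leg in `E` and the other in `M` is
also a pullback, so the two legs are jointly monic (`jointly_mono`). Hence there is at most one map
between two such spans over their feet, the bicategory is locally preordered, and coherence of
2-cells never matters. Bipullbacks and the diagonal property then become statements about the mere
existence of 2-cells (`isBipullback_iff`, `diagonalComparison_isEquivalence_iff`).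

Up to isomorphism, a member of `M_*` or `E^*` is a single arrow of `C`, and the diagrams in question
translate as follows. A 2-cell from `a^*` followed by `t_*` to `s_*` followed by `b^*` exists
exactly when the square in `C` commutes (`nonempty_square_hom_iff`). An isomorphism of the opposite
kind exists exactly when the square is a pullback (`nonempty_square_iso_iff`). Bipullback squares
inside `M_*` are the pullbacks of `C`, and those inside `E^*` are the pushouts of `C`. The second
fact becomes formally dual to the first once spans are replaced by their pushout cospans, which
(SFS5) allows without changing the 2-cells.

After this translation (V2) is existence and uniqueness of factorizations in `C`, and (V3) is
pasting and cancellation of pullbacks. (V4) is subtler, since cancellation of pushouts points the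
wrong way; the square is built from a factorization instead and then identified with the given one
(`exists_isPushout_exchange`). -/

namespace EMSpan

open CategoryTheory CategoryTheory.Limits

/-! ### Orthogonal and suitable factorization systems in a category -/

section FactorizationSystem

variable {C : Type u} [Category.{v} C] {E M : MorphismProperty C}

namespace IsFactorizationSystem

variable [IsFactorizationSystem E M]

/-- Two maps out of the codomain of a member of `E` which agree before that member and after a
member of `M` are equal. -/
theorem diagonal_ext {X Y A D : C} {e : X ⟶ Y} {m : A ⟶ D} (he : E e) (hm : M m) {f g : Y ⟶ A}
    (h₁ : e ≫ f = e ≫ g) (h₂ : f ≫ m = g ≫ m) : f = g :=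
  (existsUnique_diagonal (E := E) (M := M) e m (e ≫ g) (g ≫ m) he hm (by simp)).unique
    ⟨h₁, h₂⟩ ⟨rfl, rfl⟩

/-- Filling the square from `e` to `e ≫ m` with sides the identity and `m` gives a retraction of
`e`; uniqueness of diagonals makes it a two-sided inverse. -/
theorem isIso_left {X Y Z : C} {e : X ⟶ Y} {m : Y ⟶ Z} (he : E e) (hm : M m) (h : M (e ≫ m)) :
    IsIso e := by
  obtain ⟨d, ⟨hd₁, hd₂⟩, -⟩ :=
    existsUnique_diagonal (E := E) (M := M) e (e ≫ m) (𝟙 _) m he h (by simp)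
  exact ⟨d, hd₁, diagonal_ext he hm (by rw [← Category.assoc, hd₁]; simp) (by simpa using hd₂)⟩

theorem isIso_right {X Y Z : C} {e : X ⟶ Y} {m : Y ⟶ Z} (he : E e) (hm : M m) (h : E (e ≫ m)) :
    IsIso m := by
  obtain ⟨d, ⟨hd₁, hd₂⟩, -⟩ :=
    existsUnique_diagonal (E := E) (M := M) (e ≫ m) m e (𝟙 _) h hm (by simp)
  exact ⟨d, diagonal_ext he hm (by simpa using hd₁) (by rw [Category.assoc, hd₂]; simp), hd₂⟩

/-- The `E`-part of `f` is also the `E`-part of `f ≫ m`, hence invertible. -/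
theorem right_of_comp (E : MorphismProperty C) [IsFactorizationSystem E M]
    {X Y Z : C} {f : X ⟶ Y} {m : Y ⟶ Z} (h : M (f ≫ m)) (hm : M m) : M f := by
  obtain ⟨I, e, n, he, hn, rfl⟩ := exists_factorization (E := E) (M := M) f
  have : IsIso e := isIso_left (M := M) he (right_comp (E := E) n m hn hm) (by simpa using h)
  exact right_comp (E := E) _ _ (right_of_isIso (E := E) e this) hn

theorem left_of_comp (M : MorphismProperty C) [IsFactorizationSystem E M]
    {X Y Z : C} {e : X ⟶ Y} {f : Y ⟶ Z} (h : E (e ≫ f)) (he : E e) : E f := by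
  obtain ⟨I, e', n, he', hn, rfl⟩ := exists_factorization (E := E) (M := M) f
  have : IsIso n := isIso_right (left_comp (M := M) e e' he he') hn (by simpa using h)
  exact left_comp (M := M) _ _ he' (left_of_isIso (M := M) n this)

/-- Dual to `right_of_isPullback`: the `M`-part of `e'` is inverted by the map out of the pushout
induced by the `E`-part and a diagonal. Suitability plays no role. -/
theorem left_of_isPushout (M : MorphismProperty C) [IsFactorizationSystem E M]
    {Z X Y P : C} {f : Z ⟶ X} {e : Z ⟶ Y} {e' : X ⟶ P} {g : Y ⟶ P}
    (h : IsPushout f e e' g) (he : E e) : E e' := by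
  obtain ⟨I, c, n, hc, hn, fac⟩ := exists_factorization (E := E) (M := M) e'
  obtain ⟨d, ⟨hd₁, hd₂⟩, -⟩ := existsUnique_diagonal (E := E) (M := M) e n (f ≫ c) g he hn
    (by rw [Category.assoc, fac, h.w])
  have h₁ : h.desc c d hd₁.symm ≫ n = 𝟙 P := by
    apply h.hom_ext
    · simp [fac]
    · simp [hd₂]
  have h₂ : n ≫ h.desc c d hd₁.symm = 𝟙 I := by
    refine diagonal_ext hc hn ?_ (by simp [h₁])
    rw [← Category.assoc, fac]
    simp
  have : IsIso n := ⟨_, h₂, h₁⟩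
  rw [← fac]
  exact left_comp (M := M) _ _ hc (left_of_isIso (M := M) n this)

/-- Factorizations are unique up to isomorphism. -/
theorem exists_iso {X Y I I' : C} {e : X ⟶ I} {m : I ⟶ Y} {e' : X ⟶ I'} {m' : I' ⟶ Y}
    (he : E e) (hm : M m) (he' : E e') (hm' : M m') (h : e ≫ m = e' ≫ m') :
    ∃ i : I ≅ I', e ≫ i.hom = e' ∧ i.hom ≫ m' = m := by
  obtain ⟨s, ⟨hs₁, hs₂⟩, -⟩ := existsUnique_diagonal (E := E) (M := M) e m' e' m he hm' h.symm
  obtain ⟨t, ⟨ht₁, ht₂⟩, -⟩ := existsUnique_diagonal (E := E) (M := M) e' m e m' he' hm h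
  exact ⟨⟨s, t, diagonal_ext he hm (by rw [reassoc_of% hs₁, ht₁]; simp) (by simp [ht₂, hs₂]),
    diagonal_ext he' hm' (by rw [reassoc_of% ht₁, hs₁]; simp) (by simp [ht₂, hs₂])⟩, hs₁, hs₂⟩

end IsFactorizationSystem

namespace IsSuitable

open IsFactorizationSystem

variable [IsSuitable E M]

theorem isPushout_of_isPullback {D A B X : C} {n : D ⟶ B} {e : D ⟶ A} {d : B ⟶ X} {m : A ⟶ X}
    (h : IsPullback n e d m) (hd : E d) (hm : M m) : IsPushout n e d m :=
  (isPullback_iff_isPushout n e d m (right_of_isPullback (E := E) h hm)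
    (left_of_isPullback n e d m h hd hm) hd hm h.w).1 h

theorem isPullback_of_isPushout {D A B X : C} {n : D ⟶ B} {e : D ⟶ A} {d : B ⟶ X} {m : A ⟶ X}
    (h : IsPushout n e d m) (hn : M n) (he : E e) : IsPullback n e d m :=
  (isPullback_iff_isPushout n e d m hn he (left_of_isPushout M h he)
    (right_of_isPushout n e d m h hn he) h.w).2 h

theorem exists_isPushout {D A B : C} {n : D ⟶ B} {e : D ⟶ A} (hn : M n) (he : E e) :
    ∃ (X : C) (d : B ⟶ X) (m : A ⟶ X), E d ∧ M m ∧ IsPushout n e d m :=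
  have := hasPushout (M := M) n e he
  have h := IsPushout.of_hasPushout n e
  ⟨_, _, _, left_of_isPushout M h he, right_of_isPushout _ _ _ _ h hn he, h⟩

theorem exists_isPullback {A B X : C} {d : B ⟶ X} {m : A ⟶ X} (hd : E d) (hm : M m) :
    ∃ (D : C) (n : D ⟶ B) (e : D ⟶ A), M n ∧ E e ∧ IsPullback n e d m :=
  have := hasPullback (E := E) d m hm
  have h := IsPullback.of_hasPullback d m
  ⟨_, _, _, right_of_isPullback (E := E) h hm, left_of_isPullback _ _ _ _ h hd hm, h⟩

/-- The legs of a span with one leg in `E` and the other in `M` are jointly monic. -/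
theorem jointly_mono {K D A B : C} {n : D ⟶ B} {e : D ⟶ A} (hn : M n) (he : E e) {f g : K ⟶ D}
    (h₁ : f ≫ n = g ≫ n) (h₂ : f ≫ e = g ≫ e) : f = g := by
  -- By (SFS5) this pushout is a pullback, and pullback projections are jointly monic.
  obtain ⟨X, d, m, -, -, h⟩ := exists_isPushout hn he
  exact (isPullback_of_isPushout h hn he).hom_ext h₁ h₂

/-- The legs of a cospan with one leg in `E` and the other in `M` are jointly epic. -/
theorem jointly_epi {K A B X : C} {d : B ⟶ X} {m : A ⟶ X} (hd : E d) (hm : M m) {f g : X ⟶ K}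
    (h₁ : d ≫ f = d ≫ g) (h₂ : m ≫ f = m ≫ g) : f = g := by
  obtain ⟨D, n, e, -, -, h⟩ := exists_isPullback hd hm
  exact (isPushout_of_isPullback h hd hm).hom_ext h₁ h₂

end IsSuitable

end FactorizationSystem

/-! ### Bipullbacks and diagonals in locally preordered bicategories -/

section LocallyPreordered

open Bicategory

variable {B : Type u} [Bicategory.{w, v} B]

theorem nonempty_iso_of_isThin {C : Type*} [Category* C] [Quiver.IsThin C] {X Y : C}
    (f : X ⟶ Y) (g : Y ⟶ X) : Nonempty (X ≅ Y) :=
  ⟨⟨f, g, Subsingleton.elim _ _, Subsingleton.elim _ _⟩⟩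

theorem nonempty_equivalence_of_isThin [∀ X Y : B, Quiver.IsThin (X ⟶ Y)] {X Y : B} {f : X ⟶ Y}
    {g : Y ⟶ X} (η : 𝟙 X ≅ f ≫ g) (θ : g ≫ f ≅ 𝟙 Y) : ∃ s : X ≌ Y, s.hom = f :=
  ⟨⟨f, g, η, θ, by ext; exact Subsingleton.elim _ _⟩, rfl⟩

/-- Faithfulness is automatic, and fullness only asks that existence of arrows be reflected. -/
theorem isEquivalence_iff_of_isThin {C D : Type*} [Category* C] [Category* D] [Quiver.IsThin C]
    [Quiver.IsThin D] (F : C ⥤ D) :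
    F.IsEquivalence ↔ (∀ x y, Nonempty (F.obj x ⟶ F.obj y) → Nonempty (x ⟶ y)) ∧
      ∀ d, ∃ c, Nonempty (F.obj c ≅ d) := by
  constructor
  · intro _
    exact ⟨fun x y ⟨f⟩ => ⟨F.preimage f⟩, fun d => ⟨_, ⟨F.objObjPreimageIso d⟩⟩⟩
  · rintro ⟨h₁, h₂⟩
    exact
      { faithful := ⟨fun _ => Subsingleton.elim _ _⟩
        full := ⟨fun f => ⟨(h₁ _ _ ⟨f⟩).some, Subsingleton.elim _ _⟩⟩
        essSurj := ⟨fun d => h₂ d⟩ }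

instance CategoricalPullback.isThin {C₁ C₂ D : Type*} [Category* C₁] [Category* C₂] [Category* D]
    [Quiver.IsThin C₁] [Quiver.IsThin C₂] (F : C₁ ⥤ D) (G : C₂ ⥤ D) :
    Quiver.IsThin (CategoricalPullback F G) := fun _ _ =>
  ⟨fun _ _ => CategoricalPullback.hom_ext (Subsingleton.elim _ _) (Subsingleton.elim _ _)⟩

theorem nonempty_comp_iso {X Y Z : B} {f f' : X ⟶ Y} {g g' : Y ⟶ Z} (φ : f ≅ f') (ψ : g ≅ g') :
    Nonempty (f ≫ g ≅ f' ≫ g') :=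
  ⟨whiskerRightIso φ g ≪≫ whiskerLeftIso f' ψ⟩

variable [∀ X Y : B, Quiver.IsThin (X ⟶ Y)]

/-- The compatibility conditions in the pseudopullback hold automatically, so the criterion does not
depend on `α`. -/
theorem isBipullback_iff {P X Y Z : B} {p : P ⟶ X} {q : P ⟶ Y} {f : X ⟶ Z} {g : Y ⟶ Z}
    (α : p ≫ f ≅ q ≫ g) :
    IsBipullback α ↔ ∀ K : B,
      (∀ k k' : K ⟶ P, Nonempty (k ≫ p ⟶ k' ≫ p) → Nonempty (k ≫ q ⟶ k' ≫ q) →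
        Nonempty (k ⟶ k')) ∧
      ∀ (x : K ⟶ X) (y : K ⟶ Y), Nonempty (x ≫ f ≅ y ≫ g) →
        ∃ k : K ⟶ P, Nonempty (k ≫ p ≅ x) ∧ Nonempty (k ≫ q ≅ y) := by
  refine forall_congr' fun K => (isEquivalence_iff_of_isThin _).trans (and_congr ?_ ?_)
  · refine forall₂_congr fun k k' => ⟨?_, ?_⟩
    · rintro h ⟨η⟩ ⟨θ⟩
      exact h ⟨⟨η, θ, Subsingleton.elim _ _⟩⟩
    · rintro h ⟨η⟩
      exact h ⟨η.fst⟩ ⟨η.snd⟩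
  · constructor
    · rintro h x y ⟨i⟩
      obtain ⟨k, ⟨j⟩⟩ := h ⟨x, y, i⟩
      exact ⟨k, ⟨(CategoricalPullback.π₁ _ _).mapIso j⟩, ⟨(CategoricalPullback.π₂ _ _).mapIso j⟩⟩
    · rintro h ⟨x, y, i⟩
      obtain ⟨k, ⟨j₁⟩, ⟨j₂⟩⟩ := h x y ⟨i⟩
      exact ⟨k, ⟨CategoricalPullback.mkIso j₁ j₂ (Subsingleton.elim _ _)⟩⟩

theorem diagonalComparison_isEquivalence_iff {X Y A D : B} (e : X ⟶ Y) (m : A ⟶ D) :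
    (diagonalComparison e m).IsEquivalence ↔
      (∀ k k' : Y ⟶ A, Nonempty (e ≫ k ⟶ e ≫ k') → Nonempty (k ≫ m ⟶ k' ≫ m) →
        Nonempty (k ⟶ k')) ∧
      ∀ (x : X ⟶ A) (y : Y ⟶ D), Nonempty (x ≫ m ≅ e ≫ y) →
        ∃ k : Y ⟶ A, Nonempty (e ≫ k ≅ x) ∧ Nonempty (k ≫ m ≅ y) := by
  refine (isEquivalence_iff_of_isThin _).trans (and_congr ?_ ?_)
  · refine forall₂_congr fun k k' => ⟨?_, ?_⟩
    · rintro h ⟨η⟩ ⟨θ⟩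
      exact h ⟨⟨η, θ, Subsingleton.elim _ _⟩⟩
    · rintro h ⟨η⟩
      exact h ⟨η.fst⟩ ⟨η.snd⟩
  · constructor
    · rintro h x y ⟨i⟩
      obtain ⟨k, ⟨j⟩⟩ := h ⟨x, y, i⟩
      exact ⟨k, ⟨(CategoricalPullback.π₁ _ _).mapIso j⟩, ⟨(CategoricalPullback.π₂ _ _).mapIso j⟩⟩
    · rintro h ⟨x, y, i⟩
      obtain ⟨k, ⟨j₁⟩, ⟨j₂⟩⟩ := h x y ⟨i⟩
      exact ⟨k, ⟨CategoricalPullback.mkIso j₁ j₂ (Subsingleton.elim _ _)⟩⟩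

/-- Bipullbacks are invariant under isomorphism of the 1-cells involved. -/
theorem IsBipullback.congr {P X Y Z : B} {p p' : P ⟶ X} {q q' : P ⟶ Y} {f f' : X ⟶ Z}
    {g g' : Y ⟶ Z} {α : p ≫ f ≅ q ≫ g} (h : IsBipullback α) (ip : p ≅ p') (iq : q ≅ q')
    (jf : f ≅ f') (jg : g ≅ g') : ∃ α' : p' ≫ f' ≅ q' ≫ g', IsBipullback α' := by
  refine ⟨(whiskerRightIso ip f ≪≫ whiskerLeftIso p' jf).symm ≪≫ α ≪≫
    (whiskerRightIso iq g ≪≫ whiskerLeftIso q' jg), (isBipullback_iff _).2 fun K => ⟨?_, ?_⟩⟩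
  · rintro k k' ⟨η⟩ ⟨θ⟩
    exact ((isBipullback_iff α).1 h K).1 k k' ⟨k ◁ ip.hom ≫ η ≫ k' ◁ ip.inv⟩
      ⟨k ◁ iq.hom ≫ θ ≫ k' ◁ iq.inv⟩
  · rintro x y ⟨i⟩
    obtain ⟨k, ⟨j₁⟩, ⟨j₂⟩⟩ := ((isBipullback_iff α).1 h K).2 x y
      ⟨whiskerLeftIso x jf ≪≫ i ≪≫ (whiskerLeftIso y jg).symm⟩
    exact ⟨k, ⟨(whiskerLeftIso k ip).symm ≪≫ j₁⟩, ⟨(whiskerLeftIso k iq).symm ≪≫ j₂⟩⟩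

/-- Bipullbacks are unique up to equivalence. -/
theorem IsBipullback.exists_equivalence {P P' X Y Z : B} {p : P ⟶ X} {q : P ⟶ Y} {p' : P' ⟶ X}
    {q' : P' ⟶ Y} {f : X ⟶ Z} {g : Y ⟶ Z} {α : p ≫ f ≅ q ≫ g} {α' : p' ≫ f ≅ q' ≫ g}
    (h : IsBipullback α) (h' : IsBipullback α') :
    ∃ s : P ≌ P', Nonempty (s.hom ≫ p' ≅ p) ∧ Nonempty (s.hom ≫ q' ≅ q) := by
  rw [isBipullback_iff] at h h'
  obtain ⟨s, ⟨s₁⟩, ⟨s₂⟩⟩ := (h' P).2 p q ⟨α⟩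
  obtain ⟨t, ⟨t₁⟩, ⟨t₂⟩⟩ := (h P').2 p' q' ⟨α'⟩
  have i₁ : (s ≫ t) ≫ p ≅ 𝟙 P ≫ p := α_ s t p ≪≫ whiskerLeftIso s t₁ ≪≫ s₁ ≪≫ (λ_ p).symm
  have i₂ : (s ≫ t) ≫ q ≅ 𝟙 P ≫ q := α_ s t q ≪≫ whiskerLeftIso s t₂ ≪≫ s₂ ≪≫ (λ_ q).symm
  have j₁ : (t ≫ s) ≫ p' ≅ 𝟙 P' ≫ p' := α_ t s p' ≪≫ whiskerLeftIso t s₁ ≪≫ t₁ ≪≫ (λ_ p').symm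
  have j₂ : (t ≫ s) ≫ q' ≅ 𝟙 P' ≫ q' := α_ t s q' ≪≫ whiskerLeftIso t s₂ ≪≫ t₂ ≪≫ (λ_ q').symm
  obtain ⟨η⟩ := nonempty_iso_of_isThin ((h P).1 _ _ ⟨i₁.inv⟩ ⟨i₂.inv⟩).some
    ((h P).1 _ _ ⟨i₁.hom⟩ ⟨i₂.hom⟩).some
  obtain ⟨θ⟩ := nonempty_iso_of_isThin ((h' P').1 _ _ ⟨j₁.hom⟩ ⟨j₂.hom⟩).some
    ((h' P').1 _ _ ⟨j₁.inv⟩ ⟨j₂.inv⟩).some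
  obtain ⟨S, rfl⟩ := nonempty_equivalence_of_isThin η θ
  exact ⟨S, ⟨s₁⟩, ⟨s₂⟩⟩

/-- If a class of 1-cells is closed under the operations of a factorization system and some
bipullback of each cospan in it has projections in it, then every bipullback has. -/
theorem hasBipullbacksWithin_of_exists {W : MorphismProperty B}
    (hequiv : ∀ ⦃X Y : B⦄ (s : X ≌ Y), W s.hom)
    (hiso : ∀ ⦃X Y : B⦄ (f g : X ⟶ Y), (f ≅ g) → W f → W g)
    (hcomp : ∀ ⦃X Y Z : B⦄ (f : X ⟶ Y) (g : Y ⟶ Z), W f → W g → W (f ≫ g))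
    (H : ∀ ⦃X Y Z : B⦄ (f : X ⟶ Z) (g : Y ⟶ Z), W f → W g →
      ∃ (P : B) (p : P ⟶ X) (q : P ⟶ Y) (α : p ≫ f ≅ q ≫ g), W p ∧ W q ∧ IsBipullback α) :
    HasBipullbacksWithin W where
  exists_bipullback X Y Z f g hf hg := by
    obtain ⟨P, p, q, α, -, -, h⟩ := H f g hf hg
    exact ⟨P, p, q, α, h⟩
  projections_mem P X Y Z p q f g α hf hg h := by
    obtain ⟨P', p', q', α', hp, hq, h'⟩ := H f g hf hg
    obtain ⟨s, ⟨i⟩, ⟨j⟩⟩ := h.exists_equivalence h'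
    exact ⟨hiso _ _ i (hcomp _ _ (hequiv s) hp), hiso _ _ j (hcomp _ _ (hequiv s) hq)⟩

theorem diagonalComparison_isEquivalence_congr {X Y A D : B} {e e' : X ⟶ Y} {m m' : A ⟶ D}
    (i : e ≅ e') (j : m ≅ m') (h : (diagonalComparison e m).IsEquivalence) :
    (diagonalComparison e' m').IsEquivalence := by
  rw [diagonalComparison_isEquivalence_iff] at h ⊢
  refine ⟨?_, ?_⟩
  · rintro k k' ⟨η⟩ ⟨θ⟩
    exact h.1 k k' ⟨i.hom ▷ k ≫ η ≫ i.inv ▷ k'⟩ ⟨k ◁ j.hom ≫ θ ≫ k' ◁ j.inv⟩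
  · rintro x y ⟨t⟩
    obtain ⟨k, ⟨j₁⟩, ⟨j₂⟩⟩ := h.2 x y
      ⟨whiskerLeftIso x j ≪≫ t ≪≫ (whiskerRightIso i y).symm⟩
    exact ⟨k, ⟨(whiskerRightIso i k).symm ≪≫ j₁⟩, ⟨(whiskerLeftIso k j).symm ≪≫ j₂⟩⟩

end LocallyPreordered

open Bicategory

namespace Spn

variable {C : Type u} [Category.{v} C] {E M : MorphismProperty C} [IsSuitable E M]

open IsFactorizationSystem IsSuitable

/-! ### Calculus of spans through their legs -/

section Legs

variable {X Y Z : Spn E M}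

/-- The morphism of `Spn E M` with given legs. -/
def ofLegs {R : C} (l : R ⟶ X.as) (r : R ⟶ Y.as) (hl : E l) (hr : M r) : X ⟶ Y :=
  Span.mk (Wₗ := E) (Wᵣ := M) R l r hl hr

theorem exists_eq_ofLegs (S : X ⟶ Y) :
    ∃ (R : C) (l : R ⟶ X.as) (r : R ⟶ Y.as) (hl : E l) (hr : M r), S = ofLegs l r hl hr :=
  let S' : Span E M X.as Y.as := S
  ⟨S'.apex, S'.l, S'.r, S'.wl, S'.wr, rfl⟩

instance isThin (X Y : Spn E M) : Quiver.IsThin (X ⟶ Y) := fun (_ T : Span E M X.as Y.as) =>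
  ⟨fun η θ => Span.hom_ext (jointly_mono T.wr T.wl
    ((Span.Hom.hom_r η).trans (Span.Hom.hom_r θ).symm)
    ((Span.Hom.hom_l η).trans (Span.Hom.hom_l θ).symm))⟩

variable {R R' : C} {l : R ⟶ X.as} {r : R ⟶ Y.as} {l' : R' ⟶ X.as} {r' : R' ⟶ Y.as}

theorem nonempty_ofLegs_hom_iff {hl : E l} {hr : M r} {hl' : E l'} {hr' : M r'} :
    Nonempty ((ofLegs l r hl hr : X ⟶ Y) ⟶ ofLegs l' r' hl' hr') ↔
      ∃ φ : R ⟶ R', φ ≫ l' = l ∧ φ ≫ r' = r :=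
  ⟨fun ⟨η⟩ => ⟨Span.Hom.hom η, Span.Hom.hom_l η, Span.Hom.hom_r η⟩,
    fun ⟨φ, h₁, h₂⟩ => ⟨Span.Hom.mk φ h₁ h₂⟩⟩

theorem nonempty_ofLegs_iso_iff {hl : E l} {hr : M r} {hl' : E l'} {hr' : M r'} :
    Nonempty ((ofLegs l r hl hr : X ⟶ Y) ≅ ofLegs l' r' hl' hr') ↔
      ∃ φ : R ≅ R', φ.hom ≫ l' = l ∧ φ.hom ≫ r' = r := by
  constructor
  · rintro ⟨i⟩
    exact ⟨⟨Span.Hom.hom i.hom, Span.Hom.hom i.inv, congrArg Span.Hom.hom i.hom_inv_id,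
      congrArg Span.Hom.hom i.inv_hom_id⟩, Span.Hom.hom_l i.hom, Span.Hom.hom_r i.hom⟩
  · rintro ⟨φ, h₁, h₂⟩
    exact nonempty_iso_of_isThin (nonempty_ofLegs_hom_iff.2 ⟨φ.hom, h₁, h₂⟩).some
      (nonempty_ofLegs_hom_iff.2 ⟨φ.inv, by simp [← h₁], by simp [← h₂]⟩).some

/-- Any pullback can be used to compute the composite of two spans. -/
theorem nonempty_comp_iso_of_isPullback {P : C} {l' : R' ⟶ Y.as} {r' : R' ⟶ Z.as} {a : P ⟶ R}
    {b : P ⟶ R'} (h : IsPullback a b r l') (hl : E l) (hr : M r) (hl' : E l') (hr' : M r')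
    {l'' : P ⟶ X.as} {r'' : P ⟶ Z.as} (hl'' : E l'') (hr'' : M r'') (h₁ : a ≫ l = l'')
    (h₂ : b ≫ r' = r'') :
    Nonempty ((ofLegs l r hl hr : X ⟶ Y) ≫ (ofLegs l' r' hl' hr' : Y ⟶ Z) ≅
      ofLegs l'' r'' hl'' hr'') := by
  subst h₁ h₂
  let S : Span E M X.as Y.as := ⟨R, l, r, hl, hr⟩
  let T : Span E M Y.as Z.as := ⟨R', l', r', hl', hr'⟩
  have key : IsPullback (fst S T) (snd S T) r l' := isPullback S T
  refine nonempty_ofLegs_iso_iff (hl := (compSpan S T).wl) (hr := (compSpan S T).wr).2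
    ⟨key.isoIsPullback _ _ h, ?_, ?_⟩
  · exact key.isoIsPullback_hom_fst_assoc _ _ h l
  · exact key.isoIsPullback_hom_snd_assoc _ _ h r'

/-- The morphism of `Spn E M` given by a member of `M`. -/
def lower (m : X.as ⟶ Y.as) (hm : M m) : X ⟶ Y :=
  ofLegs (𝟙 _) m (left_of_isIso (M := M) _ inferInstance) hm

/-- The morphism of `Spn E M` given by a member of `E`. -/
def upper (e : Y.as ⟶ X.as) (he : E e) : X ⟶ Y :=
  ofLegs e (𝟙 _) he (right_of_isIso (E := E) _ inferInstance)

theorem lowerStarClass_iff_exists {S : X ⟶ Y} :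
    lowerStarClass E M S ↔ ∃ (m : X.as ⟶ Y.as) (hm : M m), Nonempty (S ≅ lower m hm) :=
  Iff.rfl

theorem upperStarClass_iff_exists {S : X ⟶ Y} :
    upperStarClass E M S ↔ ∃ (e : Y.as ⟶ X.as) (he : E e), Nonempty (S ≅ upper e he) :=
  Iff.rfl

theorem nonempty_comp_lower_iso {hl : E l} {hr : M r} {m : Y.as ⟶ Z.as} {hm : M m} :
    Nonempty ((ofLegs l r hl hr : X ⟶ Y) ≫ (lower m hm : Y ⟶ Z) ≅
      ofLegs l (r ≫ m) hl (right_comp (E := E) _ _ hr hm)) :=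
  nonempty_comp_iso_of_isPullback (IsPullback.id_horiz r) _ _ _ _ _ _ (Category.id_comp _) rfl

theorem nonempty_upper_comp_iso {l : R ⟶ Y.as} {r : R ⟶ Z.as} {hl : E l} {hr : M r}
    {e : Y.as ⟶ X.as} {he : E e} :
    Nonempty ((upper e he : X ⟶ Y) ≫ (ofLegs l r hl hr : Y ⟶ Z) ≅
      ofLegs (l ≫ e) r (left_comp (M := M) _ _ hl he) hr) :=
  nonempty_comp_iso_of_isPullback (IsPullback.id_vert l) _ _ _ _ _ _ rfl (Category.id_comp _)

theorem nonempty_lower_comp_lower_iso {m : X.as ⟶ Y.as} {n : Y.as ⟶ Z.as} {hm : M m} {hn : M n} :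
    Nonempty ((lower m hm : X ⟶ Y) ≫ (lower n hn : Y ⟶ Z) ≅
      lower (m ≫ n) (right_comp (E := E) _ _ hm hn)) :=
  nonempty_comp_lower_iso

theorem nonempty_upper_comp_upper_iso {e : Y.as ⟶ X.as} {f : Z.as ⟶ Y.as} {he : E e} {hf : E f} :
    Nonempty ((upper e he : X ⟶ Y) ≫ (upper f hf : Y ⟶ Z) ≅
      upper (f ≫ e) (left_comp (M := M) _ _ hf he)) :=
  nonempty_upper_comp_iso

theorem nonempty_upper_comp_lower_iso {e : Y.as ⟶ X.as} {m : Y.as ⟶ Z.as} {he : E e} {hm : M m} :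
    Nonempty ((upper e he : X ⟶ Y) ≫ (lower m hm : Y ⟶ Z) ≅ ofLegs e m he hm) :=
  nonempty_comp_iso_of_isPullback (IsPullback.id_horiz (𝟙 _)) _ _ _ _ _ _ (Category.id_comp _)
    (Category.id_comp _)

theorem nonempty_lower_comp_upper_iso {T : C} {x : X.as ⟶ Y.as} {a : Z.as ⟶ Y.as}
    {v : T ⟶ Z.as} {c : T ⟶ X.as} {hx : M x} {ha : E a} (h : IsPullback v c a x) :
    Nonempty ((lower x hx : X ⟶ Y) ≫ (upper a ha : Y ⟶ Z) ≅ ofLegs c v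
      (left_of_isPullback _ _ _ _ h ha hx) (right_of_isPullback (E := E) h hx)) :=
  nonempty_comp_iso_of_isPullback h.flip _ _ _ _ _ _ (Category.comp_id _) (Category.comp_id _)

/-- The identity left legs force the map of apexes to be the identity. This recovers equations in
`C` from isomorphisms in the bicategory. -/
theorem nonempty_lower_hom_iff {m m' : X.as ⟶ Y.as} {hm : M m} {hm' : M m'} :
    Nonempty ((lower m hm : X ⟶ Y) ⟶ lower m' hm') ↔ m = m' := by
  rw [lower, lower, nonempty_ofLegs_hom_iff]
  constructor
  · rintro ⟨φ, h₁, h₂⟩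
    simp_all
  · rintro rfl
    exact ⟨𝟙 _, by simp⟩

theorem nonempty_upper_hom_iff {e e' : Y.as ⟶ X.as} {he : E e} {he' : E e'} :
    Nonempty ((upper e he : X ⟶ Y) ⟶ upper e' he') ↔ e = e' := by
  rw [upper, upper, nonempty_ofLegs_hom_iff]
  constructor
  · rintro ⟨φ, h₁, h₂⟩
    simp_all
  · rintro rfl
    exact ⟨𝟙 _, by simp⟩

theorem nonempty_lower_iso {m m' : X.as ⟶ Y.as} {hm : M m} {hm' : M m'} (h : m = m') :
    Nonempty ((lower m hm : X ⟶ Y) ≅ lower m' hm') := by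
  subst h
  exact ⟨Iso.refl _⟩

theorem nonempty_upper_iso {e e' : Y.as ⟶ X.as} {he : E e} {he' : E e'} (h : e = e') :
    Nonempty ((upper e he : X ⟶ Y) ≅ upper e' he') := by
  subst h
  exact ⟨Iso.refl _⟩

theorem nonempty_hom_congr {S S' T T' : X ⟶ Y} (i : Nonempty (S ≅ S')) (j : Nonempty (T ≅ T')) :
    Nonempty (S ⟶ T) ↔ Nonempty (S' ⟶ T') :=
  (i.some.homCongr j.some).nonempty_congr

theorem nonempty_iso_congr {S S' T T' : X ⟶ Y} (i : Nonempty (S ≅ S')) (j : Nonempty (T ≅ T')) :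
    Nonempty (S ≅ T) ↔ Nonempty (S' ≅ T') :=
  (i.some.isoCongr j.some).nonempty_congr

/-- The source is the span with legs `a` and `t`, and the apex of the target is the pullback of `b`
and `s`. A map of spans is thus a map into this pullback with components `t` and `a`. -/
theorem nonempty_square_hom_iff {T : Spn E M} {a : Z.as ⟶ X.as} {t : Z.as ⟶ T.as}
    {s : X.as ⟶ Y.as} {b : T.as ⟶ Y.as} {ha : E a} {ht : M t} {hs : M s} {hb : E b} :
    Nonempty ((upper a ha : X ⟶ Z) ≫ (lower t ht : Z ⟶ T) ⟶
      (lower s hs : X ⟶ Y) ≫ (upper b hb : Y ⟶ T)) ↔ a ≫ s = t ≫ b := by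
  obtain ⟨D, n, e, -, -, h⟩ := exists_isPullback hb hs
  rw [nonempty_hom_congr nonempty_upper_comp_lower_iso (nonempty_lower_comp_upper_iso h),
    nonempty_ofLegs_hom_iff]
  constructor
  · rintro ⟨φ, rfl, rfl⟩
    simp [h.w]
  · intro hw
    exact ⟨h.lift t a hw.symm, by simp⟩

/-- The right side is the span with legs `c` and `v`; the left side is the pullback of `x` and `a`.
They are isomorphic exactly when the former is a pullback too. -/
theorem nonempty_square_iso_iff {T : Spn E M} {x : X.as ⟶ Y.as} {a : Z.as ⟶ Y.as}
    {c : T.as ⟶ X.as} {v : T.as ⟶ Z.as} {hx : M x} {ha : E a} {hc : E c} {hv : M v} :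
    Nonempty ((lower x hx : X ⟶ Y) ≫ (upper a ha : Y ⟶ Z) ≅
      (upper c hc : X ⟶ T) ≫ (lower v hv : T ⟶ Z)) ↔ IsPullback v c a x := by
  obtain ⟨D, n, e, -, -, h⟩ := exists_isPullback ha hx
  rw [nonempty_iso_congr (nonempty_lower_comp_upper_iso h) nonempty_upper_comp_lower_iso,
    nonempty_ofLegs_iso_iff]
  constructor
  · rintro ⟨φ, rfl, rfl⟩
    exact h.of_iso φ (Iso.refl _) (Iso.refl _) (Iso.refl _) (by simp) (by simp) (by simp) (by simp)
  · intro h'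
    exact ⟨h.isoIsPullback _ _ h', by simp⟩

end Legs

/-! ### The classes `E^*` and `M_*`, and the equivalences -/

section Classes

variable {X Y Z : Spn E M} {R : C} {l : R ⟶ X.as} {r : R ⟶ Y.as} {hl : E l} {hr : M r}

theorem lowerStarClass_ofLegs_iff : lowerStarClass E M (ofLegs l r hl hr : X ⟶ Y) ↔ IsIso l := by
  simp only [lowerStarClass_iff_exists, lower, nonempty_ofLegs_iso_iff]
  constructor
  · rintro ⟨m, hm, φ, rfl, -⟩
    infer_instance
  · intro h
    exact ⟨inv l ≫ r, right_comp (E := E) _ _ (right_of_isIso (E := E) _ inferInstance) hr,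
      asIso l, by simp⟩

theorem upperStarClass_ofLegs_iff : upperStarClass E M (ofLegs l r hl hr : X ⟶ Y) ↔ IsIso r := by
  simp only [upperStarClass_iff_exists, upper, nonempty_ofLegs_iso_iff]
  constructor
  · rintro ⟨m, hm, φ, -, rfl⟩
    infer_instance
  · intro h
    exact ⟨inv r ≫ l, left_comp (M := M) _ _ (left_of_isIso (M := M) _ inferInstance) hl,
      asIso r, by simp⟩

theorem lowerStarClass_lower {m : X.as ⟶ Y.as} {hm : M m} :
    lowerStarClass E M (lower m hm : X ⟶ Y) :=
  lowerStarClass_iff_exists.2 ⟨m, hm, ⟨Iso.refl _⟩⟩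

theorem upperStarClass_upper {e : Y.as ⟶ X.as} {he : E e} :
    upperStarClass E M (upper e he : X ⟶ Y) :=
  upperStarClass_iff_exists.2 ⟨e, he, ⟨Iso.refl _⟩⟩

theorem lowerStarClass_of_iso {S T : X ⟶ Y} (i : S ≅ T) (h : lowerStarClass E M S) :
    lowerStarClass E M T :=
  let ⟨m, hm, ⟨j⟩⟩ := h
  ⟨m, hm, ⟨i.symm ≪≫ j⟩⟩

theorem upperStarClass_of_iso {S T : X ⟶ Y} (i : S ≅ T) (h : upperStarClass E M S) :
    upperStarClass E M T :=
  let ⟨e, he, ⟨j⟩⟩ := h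
  ⟨e, he, ⟨i.symm ≪≫ j⟩⟩

theorem lowerStarClass_comp {S : X ⟶ Y} {T : Y ⟶ Z} (hS : lowerStarClass E M S)
    (hT : lowerStarClass E M T) : lowerStarClass E M (S ≫ T) := by
  obtain ⟨m, hm, ⟨i⟩⟩ := lowerStarClass_iff_exists.1 hS
  obtain ⟨n, hn, ⟨j⟩⟩ := lowerStarClass_iff_exists.1 hT
  exact lowerStarClass_of_iso ((nonempty_comp_iso i j).some ≪≫
    nonempty_lower_comp_lower_iso.some).symm lowerStarClass_lower

theorem upperStarClass_comp {S : X ⟶ Y} {T : Y ⟶ Z} (hS : upperStarClass E M S)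
    (hT : upperStarClass E M T) : upperStarClass E M (S ≫ T) := by
  obtain ⟨m, hm, ⟨i⟩⟩ := upperStarClass_iff_exists.1 hS
  obtain ⟨n, hn, ⟨j⟩⟩ := upperStarClass_iff_exists.1 hT
  exact upperStarClass_of_iso ((nonempty_comp_iso i j).some ≪≫
    nonempty_upper_comp_upper_iso.some).symm upperStarClass_upper

theorem nonempty_comp_iso_id_iff {R' : C} {l' : R' ⟶ Y.as} {r' : R' ⟶ X.as} {hl' : E l'}
    {hr' : M r'} {P : C} {a : P ⟶ R} {b : P ⟶ R'} (h : IsPullback a b r l') :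
    Nonempty ((ofLegs l r hl hr : X ⟶ Y) ≫ (ofLegs l' r' hl' hr' : Y ⟶ X) ≅ 𝟙 X) ↔
      ∃ φ : P ≅ X.as, φ.hom = a ≫ l ∧ φ.hom = b ≫ r' := by
  have key := nonempty_ofLegs_iso_iff (X := X) (Y := X)
    (hl := left_comp (M := M) a l (left_of_isPullback _ _ _ _ h.flip hl' hr) hl)
    (hr := right_comp (E := E) b r' (right_of_isPullback (E := E) h.flip hr) hr')
    (hl' := left_of_isIso (M := M) (𝟙 X.as) inferInstance)
    (hr' := right_of_isIso (E := E) (𝟙 X.as) inferInstance)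
  simp only [Category.comp_id] at key
  rw [← key]
  exact nonempty_iso_congr (nonempty_comp_iso_of_isPullback h _ _ _ _ _ _ rfl rfl) ⟨Iso.refl _⟩

/-- The first isomorphism makes `a ≫ l` and `b ≫ r'` invertible, so the projections `a` and `b` are
split monic. The second makes `l'` and `r` split epic, and so are their pullbacks `a` and `b`. Hence
`a` and `b` are invertible, and with them `l` and `r'`. -/
theorem isIso_of_comp_iso_id {R' : C} {l' : R' ⟶ Y.as} {r' : R' ⟶ X.as} {hl' : E l'}
    {hr' : M r'} (i : (ofLegs l r hl hr : X ⟶ Y) ≫ (ofLegs l' r' hl' hr' : Y ⟶ X) ≅ 𝟙 X)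
    (j : (ofLegs l' r' hl' hr' : Y ⟶ X) ≫ (ofLegs l r hl hr : X ⟶ Y) ≅ 𝟙 Y) :
    IsIso l ∧ IsIso r' := by
  obtain ⟨P, b, a, -, -, h⟩ := exists_isPullback hl' hr
  obtain ⟨P', b', a', -, -, h'⟩ := exists_isPullback hl hr'
  obtain ⟨φ, hφ, hφ'⟩ := (nonempty_comp_iso_id_iff h.flip).1 ⟨i⟩
  obtain ⟨ψ, hψ, hψ'⟩ := (nonempty_comp_iso_id_iff h'.flip).1 ⟨j⟩
  have hT : (ψ.inv ≫ a') ≫ l' = 𝟙 _ := by rw [Category.assoc, ← hψ]; simp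
  have hS : (ψ.inv ≫ b') ≫ r = 𝟙 _ := by rw [Category.assoc, ← hψ']; simp
  have ha : IsIso a := by
    have h₁ : a ≫ l ≫ φ.inv = 𝟙 _ := by rw [← reassoc_of% hφ]; simp
    have h₂ : h.lift (r ≫ ψ.inv ≫ a') (𝟙 _) (by simpa using r ≫= hT) ≫ a = 𝟙 _ := by simp
    have := IsSplitMono.mk' ⟨_, h₁⟩
    have := IsSplitEpi.mk' ⟨_, h₂⟩
    exact isIso_of_mono_of_isSplitEpi _
  have hb : IsIso b := by
    have h₁ : b ≫ r' ≫ φ.inv = 𝟙 _ := by rw [← reassoc_of% hφ']; simp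
    have h₂ : h.lift (𝟙 _) (l' ≫ ψ.inv ≫ b') (by simpa using (l' ≫= hS).symm) ≫ b = 𝟙 _ := by simp
    have := IsSplitMono.mk' ⟨_, h₁⟩
    have := IsSplitEpi.mk' ⟨_, h₂⟩
    exact isIso_of_mono_of_isSplitEpi _
  have e₁ : l = inv a ≫ φ.hom := by simp [hφ]
  have e₂ : r' = inv b ≫ φ.hom := by simp [hφ']
  rw [e₁, e₂]
  exact ⟨inferInstance, inferInstance⟩

theorem upperStarClass_of_equivalence (s : X ≌ Y) : upperStarClass E M s.hom := by
  obtain ⟨f, g, η, θ, -⟩ := s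
  obtain ⟨R, l, r, hl, hr, rfl⟩ := exists_eq_ofLegs f
  obtain ⟨R', l', r', hl', hr', rfl⟩ := exists_eq_ofLegs g
  exact upperStarClass_ofLegs_iff.2 (isIso_of_comp_iso_id θ η.symm).2

theorem lowerStarClass_of_equivalence (s : X ≌ Y) : lowerStarClass E M s.hom := by
  obtain ⟨f, g, η, θ, -⟩ := s
  obtain ⟨R, l, r, hl, hr, rfl⟩ := exists_eq_ofLegs f
  obtain ⟨R', l', r', hl', hr', rfl⟩ := exists_eq_ofLegs g
  exact lowerStarClass_ofLegs_iff.2 (isIso_of_comp_iso_id η.symm θ).1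

/-- An equivalence lies in both classes, so both legs are invertible. -/
theorem exists_iso_upper_of_equivalence (s : X ≌ Y) :
    ∃ (σ : Y.as ≅ X.as) (h : E σ.hom), Nonempty (s.hom ≅ upper σ.hom h) := by
  obtain ⟨σ, hσ, ⟨i⟩⟩ := upperStarClass_iff_exists.1 (upperStarClass_of_equivalence s)
  have : IsIso σ :=
    lowerStarClass_ofLegs_iff.1 (lowerStarClass_of_iso i (lowerStarClass_of_equivalence s))
  exact ⟨asIso σ, hσ, ⟨i⟩⟩

theorem exists_iso_lower_of_equivalence (s : X ≌ Y) :
    ∃ (σ : X.as ≅ Y.as) (h : M σ.hom), Nonempty (s.hom ≅ lower σ.hom h) := by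
  obtain ⟨σ, hσ, ⟨i⟩⟩ := lowerStarClass_iff_exists.1 (lowerStarClass_of_equivalence s)
  have : IsIso σ :=
    upperStarClass_ofLegs_iff.1 (upperStarClass_of_iso i (upperStarClass_of_equivalence s))
  exact ⟨asIso σ, hσ, ⟨i⟩⟩

end Classes

/-! ### Morphisms presented by cospans -/

section Cospans

variable {X Y Z : Spn E M} {Q Q' : C} {m : X.as ⟶ Q} {c : Y.as ⟶ Q} {m' : X.as ⟶ Q'}
  {c' : Y.as ⟶ Q'} {hm : M m} {hc : E c} {hm' : M m'} {hc' : E c'}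

/-- The span obtained by pulling back a cospan with left leg in `M` and right leg in `E`. -/
noncomputable def ofColegs (m : X.as ⟶ Q) (c : Y.as ⟶ Q) (hm : M m) (hc : E c) : X ⟶ Y :=
  ofLegs (exists_isPullback hc hm).choose_spec.choose_spec.choose
    (exists_isPullback hc hm).choose_spec.choose
    (exists_isPullback hc hm).choose_spec.choose_spec.choose_spec.2.1
    (exists_isPullback hc hm).choose_spec.choose_spec.choose_spec.1

variable (hm hc) in
theorem exists_ofColegs_eq : ∃ (R : C) (l : R ⟶ X.as) (r : R ⟶ Y.as) (hl : E l) (hr : M r),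
    IsPullback r l c m ∧ IsPushout r l c m ∧ ofColegs m c hm hc = ofLegs l r hl hr :=
  have h := (exists_isPullback hc hm).choose_spec.choose_spec.choose_spec.2.2
  ⟨_, _, _, _, _, h, isPushout_of_isPullback h hc hm, rfl⟩

theorem nonempty_ofColegs_iso_ofLegs {R : C} {l : R ⟶ X.as} {r : R ⟶ Y.as} {hl : E l} {hr : M r}
    (h : IsPullback r l c m) : Nonempty ((ofColegs m c hm hc : X ⟶ Y) ≅ ofLegs l r hl hr) := by
  obtain ⟨R', l', r', hl', hr', h', -, e⟩ := exists_ofColegs_eq hm hc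
  rw [e, nonempty_ofLegs_iso_iff]
  exact ⟨h'.isoIsPullback _ _ h, by simp⟩

/-- Every morphism is given by a cospan. -/
theorem exists_iso_ofColegs (S : X ⟶ Y) :
    ∃ (Q : C) (m : X.as ⟶ Q) (c : Y.as ⟶ Q) (hm : M m) (hc : E c),
      Nonempty (S ≅ ofColegs m c hm hc) := by
  obtain ⟨R, l, r, hl, hr, rfl⟩ := exists_eq_ofLegs S
  obtain ⟨Q, c, m, hc, hm, h⟩ := exists_isPushout hr hl
  exact ⟨Q, m, c, hm, hc,
    ⟨(nonempty_ofColegs_iso_ofLegs (isPullback_of_isPushout h hr hl)).some.symm⟩⟩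

/-- Each square is both a pullback and a pushout: a map of spans induces a map of pushouts, and a
map of cospans induces a map of pullbacks, in the same direction. -/
theorem nonempty_ofColegs_hom_iff :
    Nonempty ((ofColegs m c hm hc : X ⟶ Y) ⟶ ofColegs m' c' hm' hc') ↔
      ∃ φ : Q ⟶ Q', m ≫ φ = m' ∧ c ≫ φ = c' := by
  obtain ⟨R, l, r, hl, hr, -, h, e⟩ := exists_ofColegs_eq hm hc
  obtain ⟨R', l', r', hl', hr', h', -, e'⟩ := exists_ofColegs_eq hm' hc'
  rw [e, e', nonempty_ofLegs_hom_iff]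
  constructor
  · rintro ⟨φ, rfl, rfl⟩
    exact ⟨h.desc c' m' (by simp [h'.w]), by simp⟩
  · rintro ⟨φ, rfl, rfl⟩
    exact ⟨h'.lift r l (by simp [reassoc_of% h.w]), by simp⟩

theorem nonempty_ofColegs_iso_iff :
    Nonempty ((ofColegs m c hm hc : X ⟶ Y) ≅ ofColegs m' c' hm' hc') ↔
      ∃ φ : Q ≅ Q', m ≫ φ.hom = m' ∧ c ≫ φ.hom = c' := by
  constructor
  · rintro ⟨i⟩
    obtain ⟨φ, h₁, h₂⟩ := nonempty_ofColegs_hom_iff.1 ⟨i.hom⟩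
    obtain ⟨ψ, h₃, h₄⟩ := nonempty_ofColegs_hom_iff.1 ⟨i.inv⟩
    exact ⟨⟨φ, ψ, jointly_epi hc hm (by rw [reassoc_of% h₂, h₄]; simp)
      (by rw [reassoc_of% h₁, h₃]; simp), jointly_epi hc' hm' (by rw [reassoc_of% h₄, h₂]; simp)
      (by rw [reassoc_of% h₃, h₁]; simp)⟩, h₁, h₂⟩
  · rintro ⟨φ, h₁, h₂⟩
    exact nonempty_iso_of_isThin (nonempty_ofColegs_hom_iff.2 ⟨φ.hom, h₁, h₂⟩).some
      (nonempty_ofColegs_hom_iff.2 ⟨φ.inv, by simp [← h₁], by simp [← h₂]⟩).some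

/-- Pasting of pullbacks. In cospan form, composing with `e^*` alters only the right coleg, just as
composing with `m_*` alters only the right leg of a span. -/
theorem nonempty_ofColegs_comp_upper_iso {e : Z.as ⟶ Y.as} {he : E e} :
    Nonempty ((ofColegs m c hm hc : X ⟶ Y) ≫ (upper e he : Y ⟶ Z) ≅
      ofColegs m (e ≫ c) hm (left_comp (M := M) _ _ he hc)) := by
  obtain ⟨R, l, r, hl, hr, h, -, e⟩ := exists_ofColegs_eq hm hc
  obtain ⟨D, n, d, hn, hd, h'⟩ := exists_isPullback he hr
  rw [e]
  exact ⟨(nonempty_comp_iso_of_isPullback h'.flip _ _ _ _ (left_comp (M := M) _ _ hd hl) hn rfl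
    (Category.comp_id _)).some ≪≫
    (nonempty_ofColegs_iso_ofLegs (h'.paste_vert h)).some.symm⟩

end Cospans

/-! ### Bipullbacks and diagonals in terms of squares in the base category -/

section Bipullbacks

variable {P X Y Z : Spn E M}

theorem isBipullback_lower {p : P.as ⟶ X.as} {q : P.as ⟶ Y.as} {f : X.as ⟶ Z.as}
    {g : Y.as ⟶ Z.as} {hp : M p} {hq : M q} {hf : M f} {hg : M g} (h : IsPullback p q f g)
    (α : (lower p hp : P ⟶ X) ≫ (lower f hf : X ⟶ Z) ≅ (lower q hq : P ⟶ Y) ≫ lower g hg) :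
    IsBipullback α := by
  refine (isBipullback_iff α).2 fun K => ⟨fun k k' => ?_, fun x y => ?_⟩
  · obtain ⟨R, l, r, hl, hr, rfl⟩ := exists_eq_ofLegs k
    obtain ⟨R', l', r', hl', hr', rfl⟩ := exists_eq_ofLegs k'
    simp only [nonempty_hom_congr nonempty_comp_lower_iso nonempty_comp_lower_iso,
      nonempty_ofLegs_hom_iff]
    rintro ⟨φ, h₁, h₂⟩ ⟨ψ, h₃, h₄⟩
    -- The two 2-cells are a priori different maps of apexes; they agree after composing down to
    -- `Z`, where joint monicity applies.
    obtain rfl : φ = ψ := jointly_mono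
      (right_comp (E := E) _ _ hr' (right_comp (E := E) _ _ hp hf)) hl'
      (by rw [reassoc_of% h₂, h.w, reassoc_of% h₄]) (h₁.trans h₃.symm)
    exact ⟨φ, h₁, h.hom_ext (by simpa using h₂) (by simpa using h₄)⟩
  · obtain ⟨R, l, r, hl, hr, rfl⟩ := exists_eq_ofLegs x
    obtain ⟨R', l', r', hl', hr', rfl⟩ := exists_eq_ofLegs y
    simp only [nonempty_iso_congr nonempty_comp_lower_iso nonempty_comp_lower_iso,
      nonempty_ofLegs_iso_iff]
    rintro ⟨φ, rfl, h₂⟩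
    -- Composing with `p` gives `r`, so cancellation puts the induced map in `M`.
    have hk : M (h.lift r (φ.hom ≫ r') (by simp [h₂])) :=
      right_of_comp E (m := p) (by simpa using hr) hp
    refine ⟨ofLegs (φ.hom ≫ l') (h.lift r (φ.hom ≫ r') (by simp [h₂])) hl hk, ?_, ?_⟩
    · rw [nonempty_iso_congr nonempty_comp_lower_iso ⟨Iso.refl _⟩, nonempty_ofLegs_iso_iff]
      exact ⟨Iso.refl _, by simp⟩
    · rw [nonempty_iso_congr nonempty_comp_lower_iso ⟨Iso.refl _⟩, nonempty_ofLegs_iso_iff]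
      exact ⟨φ, by simp⟩

/-- The argument of `isBipullback_lower` with arrows reversed, carried out on cospans: joint epicity
replaces joint monicity. -/
theorem isBipullback_upper {p : X.as ⟶ P.as} {q : Y.as ⟶ P.as} {f : Z.as ⟶ X.as}
    {g : Z.as ⟶ Y.as} {hp : E p} {hq : E q} {hf : E f} {hg : E g} (h : IsPushout f g p q)
    (α : (upper p hp : P ⟶ X) ≫ (upper f hf : X ⟶ Z) ≅ (upper q hq : P ⟶ Y) ≫ upper g hg) :
    IsBipullback α := by
  refine (isBipullback_iff α).2 fun K => ⟨fun k k' => ?_, fun x y => ?_⟩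
  · obtain ⟨Q, m, c, hm, hc, ⟨i⟩⟩ := exists_iso_ofColegs k
    obtain ⟨Q', m', c', hm', hc', ⟨i'⟩⟩ := exists_iso_ofColegs k'
    rw [nonempty_hom_congr ⟨whiskerRightIso i _⟩ ⟨whiskerRightIso i' _⟩,
      nonempty_hom_congr (T := k' ≫ upper q hq) ⟨whiskerRightIso i _⟩ ⟨whiskerRightIso i' _⟩,
      nonempty_hom_congr (T := k') ⟨i⟩ ⟨i'⟩]
    simp only [nonempty_hom_congr nonempty_ofColegs_comp_upper_iso nonempty_ofColegs_comp_upper_iso,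
      nonempty_ofColegs_hom_iff]
    rintro ⟨φ, h₁, h₂⟩ ⟨ψ, h₃, h₄⟩
    obtain rfl : φ = ψ := jointly_epi
      (left_comp (M := M) _ _ hf (left_comp (M := M) _ _ hp hc)) hm
      (by
        simp only [Category.assoc] at h₂ h₄ ⊢
        rw [h₂, h.w_assoc, h.w_assoc, h₄]) (h₁.trans h₃.symm)
    exact ⟨φ, h₁, h.hom_ext (by simpa using h₂) (by simpa using h₄)⟩
  · obtain ⟨Q, m, c, hm, hc, ⟨i⟩⟩ := exists_iso_ofColegs x
    obtain ⟨Q', m', c', hm', hc', ⟨i'⟩⟩ := exists_iso_ofColegs y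
    rw [nonempty_iso_congr ⟨whiskerRightIso i _⟩ ⟨whiskerRightIso i' _⟩]
    simp only [nonempty_iso_congr nonempty_ofColegs_comp_upper_iso nonempty_ofColegs_comp_upper_iso,
      nonempty_ofColegs_iso_iff]
    rintro ⟨φ, rfl, h₂⟩
    have hk : E (h.desc (c ≫ φ.hom) c' (by simpa using h₂)) :=
      left_of_comp M (e := q) (by simpa using hc') hq
    refine ⟨ofColegs (m ≫ φ.hom) (h.desc (c ≫ φ.hom) c' (by simpa using h₂)) hm' hk, ?_, ?_⟩
    · rw [nonempty_iso_congr nonempty_ofColegs_comp_upper_iso ⟨i⟩, nonempty_ofColegs_iso_iff]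
      exact ⟨φ.symm, by simp⟩
    · rw [nonempty_iso_congr nonempty_ofColegs_comp_upper_iso ⟨i'⟩, nonempty_ofColegs_iso_iff]
      exact ⟨Iso.refl _, by simp⟩

theorem nonempty_lower_square_iso {p : P.as ⟶ X.as} {q : P.as ⟶ Y.as} {f : X.as ⟶ Z.as}
    {g : Y.as ⟶ Z.as} {hp : M p} {hq : M q} {hf : M f} {hg : M g} (h : p ≫ f = q ≫ g) :
    Nonempty ((lower p hp : P ⟶ X) ≫ (lower f hf : X ⟶ Z) ≅ (lower q hq : P ⟶ Y) ≫ lower g hg) := by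
  rw [nonempty_iso_congr nonempty_lower_comp_lower_iso nonempty_lower_comp_lower_iso]
  exact nonempty_lower_iso h

theorem nonempty_upper_square_iso {p : X.as ⟶ P.as} {q : Y.as ⟶ P.as} {f : Z.as ⟶ X.as}
    {g : Z.as ⟶ Y.as} {hp : E p} {hq : E q} {hf : E f} {hg : E g} (h : f ≫ p = g ≫ q) :
    Nonempty ((upper p hp : P ⟶ X) ≫ (upper f hf : X ⟶ Z) ≅ (upper q hq : P ⟶ Y) ≫ upper g hg) := by
  rw [nonempty_iso_congr nonempty_upper_comp_upper_iso nonempty_upper_comp_upper_iso]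
  exact nonempty_upper_iso h

theorem exists_isBipullback_lower {f : X.as ⟶ Z.as} {g : Y.as ⟶ Z.as} (hf : M f) (hg : M g) :
    ∃ (P : Spn E M) (p : P.as ⟶ X.as) (q : P.as ⟶ Y.as) (hp : M p) (hq : M q)
      (α : (lower p hp : P ⟶ X) ≫ (lower f hf : X ⟶ Z) ≅ (lower q hq : P ⟶ Y) ≫ lower g hg),
      IsPullback p q f g ∧ IsBipullback α := by
  have := hasPullback (E := E) f g hg
  have h := IsPullback.of_hasPullback f g
  exact ⟨⟨pullback f g⟩, _, _, right_of_isPullback (E := E) h hg,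
    right_of_isPullback (E := E) h.flip hf, (nonempty_lower_square_iso h.w).some, h,
    isBipullback_lower h _⟩

theorem exists_isBipullback_upper {f : Z.as ⟶ X.as} {g : Z.as ⟶ Y.as} (hf : E f) (hg : E g) :
    ∃ (P : Spn E M) (p : X.as ⟶ P.as) (q : Y.as ⟶ P.as) (hp : E p) (hq : E q)
      (α : (upper p hp : P ⟶ X) ≫ (upper f hf : X ⟶ Z) ≅ (upper q hq : P ⟶ Y) ≫ upper g hg),
      IsPushout f g p q ∧ IsBipullback α := by
  have := hasPushout (M := M) f g hg
  have h := IsPushout.of_hasPushout f g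
  exact ⟨⟨pushout f g⟩, _, _, left_of_isPushout M h hg,
    left_of_isPushout M h.flip hf, (nonempty_upper_square_iso h.w).some, h,
    isBipullback_upper h _⟩

/-- The genuine pullback also gives a bipullback; the equivalence comparing the two comes from an
isomorphism of `C` that respects the projections. -/
theorem isPullback_of_isBipullback_lower {p : P.as ⟶ X.as} {q : P.as ⟶ Y.as} {f : X.as ⟶ Z.as}
    {g : Y.as ⟶ Z.as} {hp : M p} {hq : M q} {hf : M f} {hg : M g}
    {α : (lower p hp : P ⟶ X) ≫ (lower f hf : X ⟶ Z) ≅ (lower q hq : P ⟶ Y) ≫ lower g hg}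
    (hα : IsBipullback α) : IsPullback p q f g := by
  obtain ⟨P', p', q', hp', hq', α', h, hα'⟩ := exists_isBipullback_lower hf hg
  obtain ⟨s, i, j⟩ := hα.exists_equivalence hα'
  obtain ⟨σ, hσ, ⟨t⟩⟩ := exists_iso_lower_of_equivalence s
  rw [nonempty_iso_congr (S' := lower _ (right_comp (E := E) _ _ hσ hp'))
    ⟨whiskerRightIso t _ ≪≫ nonempty_lower_comp_lower_iso.some⟩ ⟨Iso.refl _⟩] at i
  rw [nonempty_iso_congr (S' := lower _ (right_comp (E := E) _ _ hσ hq'))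
    ⟨whiskerRightIso t _ ≪≫ nonempty_lower_comp_lower_iso.some⟩ ⟨Iso.refl _⟩] at j
  have hi := nonempty_lower_hom_iff.1 (i.map Iso.hom)
  have hj := nonempty_lower_hom_iff.1 (j.map Iso.hom)
  exact h.of_iso σ.symm (Iso.refl _) (Iso.refl _) (Iso.refl _) (by simp [← hi]) (by simp [← hj])
    (by simp) (by simp)

theorem isPushout_of_isBipullback_upper {p : X.as ⟶ P.as} {q : Y.as ⟶ P.as} {f : Z.as ⟶ X.as}
    {g : Z.as ⟶ Y.as} {hp : E p} {hq : E q} {hf : E f} {hg : E g}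
    {α : (upper p hp : P ⟶ X) ≫ (upper f hf : X ⟶ Z) ≅ (upper q hq : P ⟶ Y) ≫ upper g hg}
    (hα : IsBipullback α) : IsPushout f g p q := by
  obtain ⟨P', p', q', hp', hq', α', h, hα'⟩ := exists_isBipullback_upper hf hg
  obtain ⟨s, i, j⟩ := hα.exists_equivalence hα'
  obtain ⟨σ, hσ, ⟨t⟩⟩ := exists_iso_upper_of_equivalence s
  rw [nonempty_iso_congr (S' := upper _ (left_comp (M := M) _ _ hp' hσ))
    ⟨whiskerRightIso t _ ≪≫ nonempty_upper_comp_upper_iso.some⟩ ⟨Iso.refl _⟩] at i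
  rw [nonempty_iso_congr (S' := upper _ (left_comp (M := M) _ _ hq' hσ))
    ⟨whiskerRightIso t _ ≪≫ nonempty_upper_comp_upper_iso.some⟩ ⟨Iso.refl _⟩] at j
  have hi := nonempty_upper_hom_iff.1 (i.map Iso.hom)
  have hj := nonempty_upper_hom_iff.1 (j.map Iso.hom)
  exact h.of_iso (Iso.refl _) (Iso.refl _) (Iso.refl _) σ (by simp) (by simp) (by simp [← hi])
    (by simp [← hj])

/-- Precomposing with `e^*` changes only left legs and postcomposing with `m_*` only right legs. The
filler therefore takes its left leg from `y` and its right leg from `x`. -/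
theorem diagonalComparison_upper_lower_isEquivalence {A D : Spn E M} {e : Y.as ⟶ X.as}
    {m : A.as ⟶ D.as} (he : E e) (hm : M m) :
    (diagonalComparison (upper e he : X ⟶ Y) (lower m hm : A ⟶ D)).IsEquivalence := by
  refine (diagonalComparison_isEquivalence_iff _ _).2 ⟨fun k k' => ?_, fun x y => ?_⟩
  · obtain ⟨R, l, r, hl, hr, rfl⟩ := exists_eq_ofLegs k
    obtain ⟨R', l', r', hl', hr', rfl⟩ := exists_eq_ofLegs k'
    simp only [nonempty_hom_congr nonempty_comp_lower_iso nonempty_comp_lower_iso,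
      nonempty_hom_congr nonempty_upper_comp_iso nonempty_upper_comp_iso,
      nonempty_ofLegs_hom_iff]
    rintro ⟨φ, h₁, h₂⟩ ⟨ψ, h₃, h₄⟩
    obtain rfl : φ = ψ := jointly_mono (right_comp (E := E) _ _ hr' hm)
      (left_comp (M := M) _ _ hl' he) (by rw [reassoc_of% h₂, h₄]) (by rw [h₁, reassoc_of% h₃])
    exact ⟨φ, h₃, h₂⟩
  · obtain ⟨R, l, r, hl, hr, rfl⟩ := exists_eq_ofLegs x
    obtain ⟨R', l', r', hl', hr', rfl⟩ := exists_eq_ofLegs y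
    rw [nonempty_iso_congr nonempty_comp_lower_iso nonempty_upper_comp_iso,
      nonempty_ofLegs_iso_iff]
    rintro ⟨φ, rfl, h₂⟩
    have hk : E (φ.hom ≫ l') := left_comp (M := M) _ _ (left_of_isIso (M := M) _ inferInstance) hl'
    refine ⟨ofLegs (φ.hom ≫ l') r hk hr, ?_, ?_⟩
    · rw [nonempty_iso_congr nonempty_upper_comp_iso ⟨Iso.refl _⟩, nonempty_ofLegs_iso_iff]
      exact ⟨Iso.refl _, by simp⟩
    · rw [nonempty_iso_congr nonempty_comp_lower_iso ⟨Iso.refl _⟩, nonempty_ofLegs_iso_iff]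
      exact ⟨φ, by simp [h₂]⟩

end Bipullbacks

end Spn

/-! ### The squares in the base category behind (V3) and (V4) -/

namespace IsSuitable

variable {C : Type u} [Category.{v} C] {E M : MorphismProperty C} [IsSuitable E M]

open IsFactorizationSystem

/-- Pasting the pullbacks at `I` and `X` gives a pullback along `a ≫ s = t ≫ b`; cancelling the one
at `J` leaves the wanted square, in which `q` is a pullback of `t`. -/
theorem exists_isPullback_exchange (E : MorphismProperty C) [IsSuitable E M]
    {X Y Z A B D I J : C} {x : X ⟶ Y} {a : Z ⟶ Y} {y : A ⟶ B}
    {b : D ⟶ B} {r : X ⟶ A} {s : Y ⟶ B} {t : Z ⟶ D} {c : I ⟶ X} {v : I ⟶ Z} {d : J ⟶ A}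
    {w : J ⟶ D} (ht : M t) (h : IsPullback x r s y) (hw : a ≫ s = t ≫ b)
    (hI : IsPullback v c a x) (hJ : IsPullback w d b y) :
    ∃ q : I ⟶ J, M q ∧ c ≫ r = q ≫ d ∧ IsPullback v q t w := by
  have hq : (v ≫ t) ≫ b = (c ≫ r) ≫ y := by
    rw [Category.assoc, ← hw, hI.w_assoc, h.w, Category.assoc]
  have sq : IsPullback v (hJ.lift _ _ hq) t w := by
    refine IsPullback.of_bot ?_ (hJ.lift_fst _ _ hq).symm hJ
    rw [hJ.lift_snd, ← hw]
    exact hI.paste_vert h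
  exact ⟨_, right_of_isPullback (E := E) sq.flip ht, (hJ.lift_snd _ _ hq).symm, sq⟩

/-- A map from `I` to `K` is available from the pullback `hK`, but knowing that the outer rectangle
and the square on `p`, `k` are pushouts does not make the remaining square one. Instead `v ≫ g` is
factored, its `E`-part is pushed out along `c`, and cancellation makes the other square a pushout as
well. Uniqueness of factorizations of `x ≫ f` identifies the new corner with `D`, and (SFS5) then
identifies the new middle object with `K`. -/
theorem exists_isPushout_exchange {D T F X Y Z K I : C} {u : D ⟶ T} {h : F ⟶ T} {x : X ⟶ Y}
    {a : Z ⟶ Y} {e : X ⟶ D} {f : Y ⟶ T} {g : Z ⟶ F} {k : K ⟶ D} {p : K ⟶ F} {c : I ⟶ X}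
    {v : I ⟶ Z} (hx : M x) (hu : M u) (ha : E a) (he : E e)
    (H : IsPushout g a h f) (hw : e ≫ u = x ≫ f) (hK : IsPullback p k h u)
    (hI : IsPullback v c a x) :
    ∃ j : I ⟶ K, E j ∧ j ≫ p = v ≫ g ∧ IsPushout j c k e := by
  have hc : E c := left_of_isPullback _ _ _ _ hI ha hx
  obtain ⟨K', j', p', hj', hp', fac⟩ := exists_factorization (E := E) (M := M) (v ≫ g)
  have big : IsPushout (j' ≫ p') c h (x ≫ f) := by
    rw [fac]
    exact (isPushout_of_isPullback hI ha hx).paste_horiz H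
  obtain ⟨D', k', e', sq⟩ : ∃ (D' : C) (k' : K' ⟶ D') (e' : X ⟶ D'), IsPushout j' c k' e' :=
    have := hasPushout (M := M) j' c hc
    ⟨_, _, _, IsPushout.of_hasPushout j' c⟩
  have hk' : E k' := left_of_isPushout M sq hc
  have he' : E e' := left_of_isPushout M sq.flip hj'
  obtain ⟨u', hu', hu''⟩ : ∃ u' : D' ⟶ T, k' ≫ u' = p' ≫ h ∧ e' ≫ u' = x ≫ f :=
    ⟨sq.desc (p' ≫ h) (x ≫ f) (by simpa using big.w), sq.inl_desc _ _ _, sq.inr_desc _ _ _⟩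
  have sq' : IsPushout p' k' h u' := IsPushout.of_left (by rwa [hu'']) hu'.symm sq
  obtain ⟨i, hi₁, hi₂⟩ := exists_iso he' (right_of_isPushout _ _ _ _ sq' hp' hk') he hu
    (hu''.trans hw.symm)
  have hK' : IsPullback p' (k' ≫ i.hom) h u :=
    (isPullback_of_isPushout sq' hp' hk').of_iso (Iso.refl _) (Iso.refl _) i (Iso.refl _)
      (by simp) (by simp) (by simp) (by simp [hi₂])
  refine ⟨j' ≫ (hK'.isoIsPullback _ _ hK).hom, left_comp (M := M) _ _ hj'
    (left_of_isIso (M := M) _ inferInstance), by simp [fac], ?_⟩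
  exact sq.of_iso (Iso.refl _) (hK'.isoIsPullback _ _ hK) (Iso.refl _) i (by simp) (by simp)
    (by simp) (by simp [hi₁])

end IsSuitable

/-! ### Verification of the axioms -/

namespace Spn

variable {C : Type u} [Category.{v} C] (E M : MorphismProperty C) [IsSuitable E M]

open IsFactorizationSystem IsSuitable

variable {E M} in
-- Both forms are needed for uniqueness in (V2), where one equivalence is composed with a member of
-- each class.
theorem exists_equivalence_of_iso {X Y : Spn E M} (σ : X.as ≅ Y.as) :
    ∃ s : X ≌ Y,
      Nonempty (s.hom ≅ lower σ.hom (right_of_isIso (E := E) _ inferInstance)) ∧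
      Nonempty (s.hom ≅ upper σ.inv (left_of_isIso (M := M) _ inferInstance)) := by
  have η : 𝟙 X ≅ (lower σ.hom (right_of_isIso (E := E) _ inferInstance) : X ⟶ Y) ≫
      lower σ.inv (right_of_isIso (E := E) _ inferInstance) :=
    (nonempty_lower_iso (m := 𝟙 X.as) (hm := right_of_isIso (E := E) _ inferInstance)
      (by simp)).some ≪≫ nonempty_lower_comp_lower_iso.some.symm
  have θ : (lower σ.inv (right_of_isIso (E := E) _ inferInstance) : Y ⟶ X) ≫
      lower σ.hom (right_of_isIso (E := E) _ inferInstance) ≅ 𝟙 Y :=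
    nonempty_lower_comp_lower_iso.some ≪≫ (nonempty_lower_iso (m' := 𝟙 Y.as)
      (hm' := right_of_isIso (E := E) _ inferInstance) (by simp)).some
  obtain ⟨s, hs⟩ := nonempty_equivalence_of_isThin η θ
  refine ⟨s, ⟨eqToIso hs⟩, ?_⟩
  rw [hs, lower, upper, nonempty_ofLegs_iso_iff]
  exact ⟨σ, by simp⟩

theorem isBicatFactorizationSystem :
    IsBicatFactorizationSystem (upperStarClass E M) (lowerStarClass E M) where
  left_of_equivalence _ _ f := fun ⟨s, ⟨i⟩⟩ =>
    upperStarClass_of_iso i (upperStarClass_of_equivalence s)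
  right_of_equivalence _ _ f := fun ⟨s, ⟨i⟩⟩ =>
    lowerStarClass_of_iso i (lowerStarClass_of_equivalence s)
  left_of_iso _ _ _ _ i := upperStarClass_of_iso i
  right_of_iso _ _ _ _ i := lowerStarClass_of_iso i
  left_comp _ _ _ _ _ := upperStarClass_comp
  right_comp _ _ _ _ _ := lowerStarClass_comp
  diagonal X Y A D e m he hm := by
    obtain ⟨e, he, ⟨i⟩⟩ := upperStarClass_iff_exists.1 he
    obtain ⟨m, hm, ⟨j⟩⟩ := lowerStarClass_iff_exists.1 hm
    exact diagonalComparison_isEquivalence_congr i.symm j.symm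
      (diagonalComparison_upper_lower_isEquivalence he hm)
  exists_factorization X Y f := by
    obtain ⟨R, l, r, hl, hr, rfl⟩ := exists_eq_ofLegs f
    exact ⟨⟨R⟩, upper l hl, lower r hr, upperStarClass_upper, lowerStarClass_lower,
      nonempty_upper_comp_lower_iso⟩

theorem hasBipullbacksWithin_upperStarClass : HasBipullbacksWithin (upperStarClass E M) := by
  refine hasBipullbacksWithin_of_exists (fun _ _ => upperStarClass_of_equivalence)
    (fun _ _ _ _ i => upperStarClass_of_iso i) (fun _ _ _ _ _ => upperStarClass_comp) ?_
  intro X Y Z f g hf hg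
  obtain ⟨f, hf, ⟨i⟩⟩ := upperStarClass_iff_exists.1 hf
  obtain ⟨g, hg, ⟨j⟩⟩ := upperStarClass_iff_exists.1 hg
  obtain ⟨P, p, q, hp, hq, α, -, hα⟩ := exists_isBipullback_upper hf hg
  obtain ⟨α', hα'⟩ := hα.congr (Iso.refl _) (Iso.refl _) i.symm j.symm
  exact ⟨P, _, _, α', upperStarClass_upper, upperStarClass_upper, hα'⟩

theorem hasBipullbacksWithin_lowerStarClass : HasBipullbacksWithin (lowerStarClass E M) := by
  refine hasBipullbacksWithin_of_exists (fun _ _ => lowerStarClass_of_equivalence)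
    (fun _ _ _ _ i => lowerStarClass_of_iso i) (fun _ _ _ _ _ => lowerStarClass_comp) ?_
  intro X Y Z f g hf hg
  obtain ⟨f, hf, ⟨i⟩⟩ := lowerStarClass_iff_exists.1 hf
  obtain ⟨g, hg, ⟨j⟩⟩ := lowerStarClass_iff_exists.1 hg
  obtain ⟨P, p, q, hp, hq, α, -, hα⟩ := exists_isBipullback_lower hf hg
  obtain ⟨α', hα'⟩ := hα.congr (Iso.refl _) (Iso.refl _) i.symm j.symm
  exact ⟨P, _, _, α', lowerStarClass_lower, lowerStarClass_lower, hα'⟩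

theorem fakePullbackReady :
    FakePullbackReady (B := Spn E M) (upperStarClass E M) (lowerStarClass E M) where
  locallyPreordered := isThin
  factorizationSystem := isBicatFactorizationSystem E M
  bipullbacks_left := hasBipullbacksWithin_upperStarClass E M
  bipullbacks_right := hasBipullbacksWithin_lowerStarClass E M
  exists_square X Y Z a x ha hx := by
    obtain ⟨a, ha, ⟨i⟩⟩ := upperStarClass_iff_exists.1 ha
    obtain ⟨x, hx, ⟨j⟩⟩ := lowerStarClass_iff_exists.1 hx
    -- By `nonempty_square_hom_iff`, completing the cospan is the same as factoring this composite
    -- in `C`.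
    obtain ⟨T, b, y, hb, hy, fac⟩ := exists_factorization (E := E) (M := M) (x ≫ a)
    refine ⟨⟨T⟩, upper b hb, lower y hy, upperStarClass_upper, lowerStarClass_lower, ?_⟩
    rw [nonempty_hom_congr ⟨whiskerLeftIso _ j⟩ ⟨whiskerLeftIso _ i⟩]
    exact nonempty_square_hom_iff.2 fac
  square_unique X Y Z a x ha hx T T' b y b' y' hb hy η hb' hy' η' := by
    obtain ⟨a, ha, ⟨ia⟩⟩ := upperStarClass_iff_exists.1 ha
    obtain ⟨x, hx, ⟨ix⟩⟩ := lowerStarClass_iff_exists.1 hx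
    obtain ⟨b, hb, ⟨ib⟩⟩ := upperStarClass_iff_exists.1 hb
    obtain ⟨y, hy, ⟨iy⟩⟩ := lowerStarClass_iff_exists.1 hy
    obtain ⟨b', hb', ⟨ib'⟩⟩ := upperStarClass_iff_exists.1 hb'
    obtain ⟨y', hy', ⟨iy'⟩⟩ := lowerStarClass_iff_exists.1 hy'
    have h := nonempty_square_hom_iff.1
      ((nonempty_hom_congr (nonempty_comp_iso ib ix) (nonempty_comp_iso iy ia)).1 ⟨η⟩)
    have h' := nonempty_square_hom_iff.1
      ((nonempty_hom_congr (nonempty_comp_iso ib' ix) (nonempty_comp_iso iy' ia)).1 ⟨η'⟩)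
    obtain ⟨σ, hσ₁, hσ₂⟩ := exists_iso hb hy hb' hy' (h.trans h'.symm)
    obtain ⟨s, ⟨i⟩, ⟨j⟩⟩ := exists_equivalence_of_iso (E := E) (M := M) σ
    refine ⟨s, ?_, ?_⟩
    · rw [nonempty_iso_congr ⟨whiskerRightIso j _ ≪≫ whiskerLeftIso _ ib' ≪≫
        nonempty_upper_comp_upper_iso.some⟩ ⟨ib⟩]
      exact nonempty_upper_iso (by simp [← hσ₁])
    · rw [nonempty_iso_congr ⟨whiskerRightIso i _ ≪≫ whiskerLeftIso _ iy' ≪≫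
        nonempty_lower_comp_lower_iso.some⟩ ⟨iy⟩]
      exact nonempty_lower_iso hσ₂
  exchange_right X Y Z A B' D x a y b r s t α hr hs ht hx hy ha hb hα η I J c v d w hc hv hd hw
      i j := by
    obtain ⟨x, hx, ⟨ix⟩⟩ := lowerStarClass_iff_exists.1 hx
    obtain ⟨a, ha, ⟨ia⟩⟩ := upperStarClass_iff_exists.1 ha
    obtain ⟨y, hy, ⟨iy⟩⟩ := lowerStarClass_iff_exists.1 hy
    obtain ⟨b, hb, ⟨ib⟩⟩ := upperStarClass_iff_exists.1 hb
    obtain ⟨r, hr, ⟨ir⟩⟩ := lowerStarClass_iff_exists.1 hr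
    obtain ⟨s, hs, ⟨is⟩⟩ := lowerStarClass_iff_exists.1 hs
    obtain ⟨t, ht, ⟨it⟩⟩ := lowerStarClass_iff_exists.1 ht
    obtain ⟨c, hc, ⟨ic⟩⟩ := upperStarClass_iff_exists.1 hc
    obtain ⟨v, hv, ⟨iv⟩⟩ := lowerStarClass_iff_exists.1 hv
    obtain ⟨d, hd, ⟨id⟩⟩ := upperStarClass_iff_exists.1 hd
    obtain ⟨w, hw, ⟨iw⟩⟩ := lowerStarClass_iff_exists.1 hw
    -- Passing to the representatives `m_*` and `e^*` makes the bipullback a pullback in `C`, the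
    -- 2-cell a commutative square, and the two factorizations pullbacks.
    obtain ⟨α', hα'⟩ := hα.congr ix ir is iy
    obtain ⟨q, hq, comm, sq⟩ := exists_isPullback_exchange E ht
      (isPullback_of_isBipullback_lower hα')
      (nonempty_square_hom_iff.1
        ((nonempty_hom_congr (nonempty_comp_iso ia it) (nonempty_comp_iso is ib)).1 ⟨η⟩))
      (nonempty_square_iso_iff.1
        ((nonempty_iso_congr (nonempty_comp_iso ix ia) (nonempty_comp_iso ic iv)).1 ⟨i⟩))
      (nonempty_square_iso_iff.1
        ((nonempty_iso_congr (nonempty_comp_iso iy ib) (nonempty_comp_iso id iw)).1 ⟨j⟩))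
    refine ⟨lower q hq, lowerStarClass_lower, ?_, ?_⟩
    · rw [nonempty_hom_congr ⟨whiskerRightIso ic _⟩ (nonempty_comp_iso ir id)]
      exact nonempty_square_hom_iff.2 comm
    · exact (isBipullback_lower sq (nonempty_lower_square_iso sq.w).some).congr iv.symm
        (Iso.refl _) it.symm iw.symm
  exchange_left D T F X Y Z u h x a e f g α hx hu hh ha he hf hg hα η K I k p c v hk hp hc hv
      i j := by
    obtain ⟨u, hu, ⟨iu⟩⟩ := lowerStarClass_iff_exists.1 hu
    obtain ⟨h, hh, ⟨ih⟩⟩ := upperStarClass_iff_exists.1 hh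
    obtain ⟨x, hx, ⟨ix⟩⟩ := lowerStarClass_iff_exists.1 hx
    obtain ⟨a, ha, ⟨ia⟩⟩ := upperStarClass_iff_exists.1 ha
    obtain ⟨e, he, ⟨ie⟩⟩ := upperStarClass_iff_exists.1 he
    obtain ⟨f, hf, ⟨jf⟩⟩ := upperStarClass_iff_exists.1 hf
    obtain ⟨g, hg, ⟨ig⟩⟩ := upperStarClass_iff_exists.1 hg
    obtain ⟨k, hk, ⟨ik⟩⟩ := upperStarClass_iff_exists.1 hk
    obtain ⟨p, hp, ⟨ip⟩⟩ := lowerStarClass_iff_exists.1 hp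
    obtain ⟨c, hc, ⟨ic⟩⟩ := upperStarClass_iff_exists.1 hc
    obtain ⟨v, hv, ⟨iv⟩⟩ := lowerStarClass_iff_exists.1 hv
    -- Here the bipullback of members of `E^*` becomes a pushout in `C`, while the factorizations
    -- still become pullbacks.
    obtain ⟨α', hα'⟩ := hα.congr ih jf ig ia
    obtain ⟨q, hq, comm, sq⟩ := exists_isPushout_exchange hx hu ha he
      (isPushout_of_isBipullback_upper hα')
      (nonempty_square_hom_iff.1
        ((nonempty_hom_congr (nonempty_comp_iso ie ix) (nonempty_comp_iso iu jf)).1 ⟨η⟩))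
      (nonempty_square_iso_iff.1
        ((nonempty_iso_congr (nonempty_comp_iso iu ih) (nonempty_comp_iso ik ip)).1 ⟨i⟩))
      (nonempty_square_iso_iff.1
        ((nonempty_iso_congr (nonempty_comp_iso ix ia) (nonempty_comp_iso ic iv)).1 ⟨j⟩))
    refine ⟨upper q hq, upperStarClass_upper, ?_, ?_⟩
    · rw [nonempty_hom_congr ⟨whiskerLeftIso _ iv⟩ (nonempty_comp_iso ip ig)]
      exact nonempty_square_hom_iff.2 comm
    · exact (isBipullback_upper sq (nonempty_upper_square_iso sq.w).some).congr ik.symm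
        ie.symm (Iso.refl _) ic.symm

end Spn

end EMSpan

theorem mainTheorem2 {C : Type u} [CategoryTheory.Category.{v} C]
    (E M : CategoryTheory.MorphismProperty C) [EMSpan.IsSuitable E M] :
    EMSpan.FakePullbackReady (B := EMSpan.Spn E M)
      (EMSpan.Spn.upperStarClass E M) (EMSpan.Spn.lowerStarClass E M) :=
  EMSpan.Spn.fakePullbackReady E M
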